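/- Let $A$ and $B$ be quantum systems with finite-dimensional complex Hilbert spaces $\mathcal H_A,\mathcal H_B$. Let $\log$ be the logarithm to an arbitrary fixed basis $b>1$ (with $\log 0=-\infty$) and $\exp$ its inverse, $\exp(x)=b^x$. For a system $X$ write $\mathcal S_\bullet(X)$ (resp. $\mathcal S_\circ(X)$) for the set of positive semi-definite operators on $\mathcal H_X$ with trace at most $1$ (resp. equal to $1$). For positive semi-definite $\rho,\tau$ let $F(\rho,\tau)=\big(\operatorname{tr}|\sqrt\rho\sqrt\tau|\big)^2$. For $\rho,\tau\in\mathcal S_\bullet(X)$ let $$F_*(\rho,\tau)=\Big(\operatorname{tr}|\sqrt\rho\sqrt\tau|+\sqrt{(1-\operatorname{tr}\rho)(1-\operatorname{tr}\tau)}\Big)^2,\qquad P(\rho,\tau)=\sqrt{1-F_*(\rho,\tau)},$$ and $\mathcal B^\varepsilon(\rho)=\{\tau\in\mathcal S_\bullet(X): P(\tau,\rho)\le\varepsilon\}$. For $\rho_{AB}\in\mathcal S_\bullet(AB)$ let $$H_{\min}(A|B)_\rho=\sup_{\sigma_B\in\mathcal S_\bullet(B)}\sup\{\lambda\in\mathbb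 R:\rho_{AB}\le\exp(-\lambda)\,\mathrm{id}_A\otimes\sigma_B\},\qquad H_{\max}(A|B)_\rho=\sup_{\sigma_B\in\mathcal S_\bullet(B)}\log F(\rho_{AB},\mathrm{id}_A\otimes\sigma_B),$$ $$H_{\min}^\varepsilon(A|B)_\rho=\sup_{\tilde\rho\in\mathcal B^\varepsilon(\rho_{AB})}H_{\min}(A|B)_{\tilde\rho},\qquad H_{\max}^\varepsilon(A|B)_\rho=\inf_{\tilde\rho\in\mathcal B^\varepsilon(\rho_{AB})}H_{\max}(A|B)_{\tilde\rho}.$$ Finally, for $\rho_{AB}\in\mathcal S_\circ(AB)$ let $H(A|B)_\rho=-\operatorname{tr}(\rho_{AB}\log\rho_{AB})+\operatorname{tr}(\rho_B\log\rho_B)$ with $\rho_B=\operatorname{tr}_A\rho_{AB}$ and the convention $0\log 0=0$. **Statement.** Let $\rho_{AB}\in\mathcal S_\circ(AB)$ and $0\le\varepsilon<1$. Then the smooth entropies of the i.i.d. product state $\rho_{A^nB^n}=\rho_{AB}^{\otimes n}$ satisfy the following: both limits below exist as real numbers, and $$\lim_{n\to\infty}\Big\{\tfrac1n H_{\min}^\varepsilon(A^n|B^n)_{\rho^{\otimes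 n}}\Big\}\le H(A|B)_\rho\qquad\text{and}\qquad\lim_{n\to\infty}\Big\{\tfrac1n H_{\max}^\varepsilon(A^n|B^n)_{\rho^{\otimes n}}\Big\}\ge H(A|B)_\rho.$$ -/

import Mathlib

open Filter Topology
open scoped Matrix MatrixOrder ComplexOrder Kronecker

/-! Operators on a finite-dimensional Hilbert space `H_A` are matrices indexed by a finite type `A`
(an orthonormal basis of `H_A`); the joint system `AB` is indexed by `A × B`, and `Aⁿ` by
`Fin n → A`. The parameter `b > 1` is the basis of the logarithm, whose inverse is `x ↦ b ^ x`. -/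

noncomputable section

namespace QInfo

variable {A B : Type*} [Fintype A] [DecidableEq A] [Fintype B] [DecidableEq B]

/-- Normalized density operators. -/
def IsState (ρ : Matrix A A ℂ) : Prop :=
  ρ.PosSemidef ∧ ρ.trace = 1

/-- Sub-normalized density operators. -/
def IsSubnormalized (ρ : Matrix A A ℂ) : Prop :=
  ρ.PosSemidef ∧ ρ.trace.re ≤ 1

/-- The marginal on `B` of an operator on `AB` (partial trace over `A`). -/
def marginalRight (ρ : Matrix (A × B) (A × B) ℂ) : Matrix B B ℂ :=
  Matrix.of fun y y' => ∑ x, ρ (x, y) (x, y')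

/-- The `n`-fold tensor power of an operator on `AB`, as an operator on `AⁿBⁿ`. -/
def iidPower (n : ℕ) (ρ : Matrix (A × B) (A × B) ℂ) :
    Matrix ((Fin n → A) × (Fin n → B)) ((Fin n → A) × (Fin n → B)) ℂ :=
  Matrix.of fun p q => ∏ i, ρ (p.1 i, p.2 i) (q.1 i, q.2 i)

/-- The von Neumann entropy `-tr (ρ log ρ)`. Since `Real.logb b 0 = 0`, the functional calculus
ignores the kernel of `ρ`. -/
def vonNeumannEntropy (b : ℝ) (ρ : Matrix A A ℂ) : ℝ :=
  -(ρ * cfc (Real.logb b) ρ).trace.re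

/-- The conditional von Neumann entropy `H(A|B) = H(AB) - H(B)`. -/
def condEntropy (b : ℝ) (ρ : Matrix (A × B) (A × B) ℂ) : ℝ :=
  vonNeumannEntropy b ρ - vonNeumannEntropy b (marginalRight ρ)

/-- The root fidelity `tr |√ρ √τ|` of positive semi-definite operators. -/
def sqrtFidelity (ρ τ : Matrix A A ℂ) : ℝ :=
  (CFC.abs (CFC.sqrt ρ * CFC.sqrt τ)).trace.re

/-- The fidelity `(tr |√ρ √τ|)²`. -/
def fidelity (ρ τ : Matrix A A ℂ) : ℝ :=
  sqrtFidelity ρ τ ^ 2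

/-- The generalized fidelity of sub-normalized density operators. -/
def genFidelity (ρ τ : Matrix A A ℂ) : ℝ :=
  (sqrtFidelity ρ τ + √((1 - ρ.trace.re) * (1 - τ.trace.re))) ^ 2

/-- The purified distance of sub-normalized density operators. -/
def purifiedDistance (ρ τ : Matrix A A ℂ) : ℝ :=
  √(1 - genFidelity ρ τ)

/-- The `ε`-ball of sub-normalized density operators around `ρ`. -/
def ball (ε : ℝ) (ρ : Matrix A A ℂ) : Set (Matrix A A ℂ) :=
  {τ | IsSubnormalized τ ∧ purifiedDistance τ ρ ≤ ε}

/-- The logarithm of a nonnegative real, with `log 0 = -∞`. -/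
def elogb (b x : ℝ) : EReal :=
  if 0 < x then (Real.logb b x : EReal) else ⊥

/-- The min-entropy `H_min(A|B)`. -/
def minEntropy (b : ℝ) (ρ : Matrix (A × B) (A × B) ℂ) : EReal :=
  ⨆ (σ : Matrix B B ℂ) (_ : IsSubnormalized σ) (t : ℝ)
    (_ : ρ ≤ (b ^ (-t)) • ((1 : Matrix A A ℂ) ⊗ₖ σ)), (t : EReal)

/-- The max-entropy `H_max(A|B)`. -/
def maxEntropy (b : ℝ) (ρ : Matrix (A × B) (A × B) ℂ) : EReal :=
  ⨆ (σ : Matrix B B ℂ) (_ : IsSubnormalized σ),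
    elogb b (fidelity ρ ((1 : Matrix A A ℂ) ⊗ₖ σ))

/-- The `ε`-smooth min-entropy. -/
def smoothMinEntropy (b ε : ℝ) (ρ : Matrix (A × B) (A × B) ℂ) : EReal :=
  ⨆ τ ∈ ball ε ρ, minEntropy b τ

/-- The `ε`-smooth max-entropy. -/
def smoothMaxEntropy (b ε : ℝ) (ρ : Matrix (A × B) (A × B) ℂ) : EReal :=
  ⨅ τ ∈ ball ε ρ, maxEntropy b τ

end QInfo

end

/-! Everything is driven by one operator, the filter `L = (1 ⊗ Q) P`, with `P` a spectral projection
of `ρ_AB` and `Q` one of `ρ_B`. Since `ρ` is normalized, the extra term of the generalized fidelity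
vanishes and membership in the `ε`-ball reads `√(1 - ε²) ≤ tr |√τ √ρ|`. Replacing `√ρ` by `L √ρ`
changes this root fidelity by at most `‖(1 - L) √ρ‖₂`, which `filterDefect` bounds.

Two choices of `L` are used. If `P` cuts off the large eigenvalues (`P ρ P ≤ μ`) and `Q` the small
ones (`Q ≤ θ ρ_B`), then `L ρ Lᴴ ≤ μθ (1 ⊗ ρ_B)`; this bounds both smooth entropies from below. If
the roles are exchanged (`P ≤ θ ρ`, `Q ρ_B Q ≤ μ`), then `tr (L Lᴴ (1 ⊗ σ)) ≤ θμ` for every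
subnormalized `σ`; this bounds both from above. In each case one entropy is handled by smoothing to
the state `L ρ Lᴴ`, the other by testing an arbitrary `τ` in the ball against `L`.

For `ρ^{⊗n}` the thresholds are placed at `b^{-n(H ± δ)}`, and a Chernoff bound makes the defect
tend to `0`. The exponents then combine to `n (H(AB) - H(B))` up to a multiple of `nδ` and a
constant. The bounds that the statement asks for hold for all `0 ≤ ε < 1`. The opposite bounds need
`L ρ Lᴴ` to lie in the ball, hence `ε > 0`; then both limits exist and equal `H(A|B)`.

For `ε = 0` the ball is `{ρ}` (`ball_zero`), and the unsmoothed entropies are superadditive under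
tensor products and linearly bounded, so Fekete's lemma supplies the limits. -/

noncomputable section

namespace QInfo

open Matrix

set_option linter.unusedSectionVars false

/-! ### Contractions, the trace norm and the root fidelity -/

section TraceNorm

variable {I : Type*} [Fintype I]

/-- The entries of a matrix as a Euclidean vector. -/
def vec (M : Matrix I I ℂ) : EuclideanSpace ℂ (I × I) := WithLp.toLp 2 fun p => M p.1 p.2

/-- The Hilbert–Schmidt norm. -/
def hsNorm (M : Matrix I I ℂ) : ℝ := ‖vec M‖

lemma inner_vec (M N : Matrix I I ℂ) : inner ℂ (vec M) (vec N) = (Mᴴ * N).trace := by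
  simp only [vec, PiLp.inner_apply, RCLike.inner_apply, trace, diag_apply, mul_apply,
    conjTranspose_apply, Fintype.sum_prod_type]
  rw [Finset.sum_comm]
  simp [mul_comm]

lemma hsNorm_nonneg (M : Matrix I I ℂ) : 0 ≤ hsNorm M := norm_nonneg _

lemma hsNorm_sq (M : Matrix I I ℂ) : hsNorm M ^ 2 = (Mᴴ * M).trace.re := by
  rw [← inner_vec, hsNorm, ← inner_self_eq_norm_sq (𝕜 := ℂ)]; rfl

lemma hsNorm_add_le (M N : Matrix I I ℂ) : hsNorm (M + N) ≤ hsNorm M + hsNorm N :=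
  norm_add_le (vec M) (vec N)

lemma norm_trace_le (M N : Matrix I I ℂ) : ‖(Mᴴ * N).trace‖ ≤ hsNorm M * hsNorm N := by
  rw [← inner_vec]; exact norm_inner_le_norm _ _

lemma hsNorm_conjTranspose (M : Matrix I I ℂ) : hsNorm Mᴴ = hsNorm M := by
  rw [← sq_eq_sq₀ (hsNorm_nonneg _) (hsNorm_nonneg _), hsNorm_sq, hsNorm_sq, trace_mul_comm]
  simp

lemma trace_re_nonneg {M : Matrix I I ℂ} (h : 0 ≤ M) : 0 ≤ M.trace.re :=
  (Complex.le_def.1 (Matrix.nonneg_iff_posSemidef.1 h).trace_nonneg).1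

lemma trace_re_mono {M N : Matrix I I ℂ} (h : M ≤ N) : M.trace.re ≤ N.trace.re := by
  have := trace_re_nonneg (sub_nonneg.2 h)
  simpa [trace_sub] using this

lemma conj_le_conj {M N : Matrix I I ℂ} (h : M ≤ N) (K : Matrix I I ℂ) :
    Kᴴ * M * K ≤ Kᴴ * N * K := star_left_conjugate_le_conjugate h K

lemma conj_le_conj' {M N : Matrix I I ℂ} (h : M ≤ N) (K : Matrix I I ℂ) :
    K * M * Kᴴ ≤ K * N * Kᴴ := star_right_conjugate_le_conjugate h K

lemma star_dotProduct_gram [DecidableEq I] (Z : Matrix I I ℂ) (v : EuclideanSpace ℂ I) :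
    star v.ofLp ⬝ᵥ ((Zᴴ * Z) *ᵥ v.ofLp) = ((‖toEuclideanLin Z v‖ ^ 2 : ℝ) : ℂ) := by
  rw [← mulVec_mulVec, dotProduct_mulVec _ Zᴴ, ← star_mulVec]
  have := inner_self_eq_norm_sq_to_K (𝕜 := ℂ) (toEuclideanLin Z v)
  rw [EuclideanSpace.inner_eq_star_dotProduct, dotProduct_comm] at this
  simpa using this

variable [DecidableEq I]

/-- Contractions. -/
def IsContraction (W : Matrix I I ℂ) : Prop := Wᴴ * W ≤ 1

lemma hsNorm_contraction_mul {W : Matrix I I ℂ} (hW : IsContraction W) (M : Matrix I I ℂ) :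
    hsNorm (W * M) ≤ hsNorm M := by
  rw [← sq_le_sq₀ (hsNorm_nonneg _) (hsNorm_nonneg _), hsNorm_sq, hsNorm_sq]
  apply trace_re_mono
  simpa [mul_assoc] using conj_le_conj hW M

lemma isContraction_one : IsContraction (1 : Matrix I I ℂ) := by simp [IsContraction]

lemma IsContraction.mul {W V : Matrix I I ℂ} (hW : IsContraction W) (hV : IsContraction V) :
    IsContraction (W * V) := by
  have := conj_le_conj hW V
  simp only [IsContraction, conjTranspose_mul] at *
  refine le_trans ?_ hV
  simpa [mul_assoc] using this

lemma isContraction_iff_norm {W : Matrix I I ℂ} :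
    IsContraction W ↔ ∀ v, ‖toEuclideanLin W v‖ ≤ ‖v‖ := by
  have key (v : EuclideanSpace ℂ I) :
      star v.ofLp ⬝ᵥ ((1 - Wᴴ * W) *ᵥ v.ofLp) = ((‖v‖ ^ 2 - ‖toEuclideanLin W v‖ ^ 2 : ℝ) : ℂ) := by
    rw [sub_mulVec, dotProduct_sub, star_dotProduct_gram, one_mulVec]
    have := inner_self_eq_norm_sq_to_K (𝕜 := ℂ) v
    rw [EuclideanSpace.inner_eq_star_dotProduct, dotProduct_comm] at this
    rw [this]
    simp
  constructor
  · intro h v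
    have h1 := (Matrix.le_iff.1 h).dotProduct_mulVec_nonneg v.ofLp
    rw [key] at h1
    have : (0:ℝ) ≤ ‖v‖ ^ 2 - ‖toEuclideanLin W v‖ ^ 2 := by exact_mod_cast h1
    exact (sq_le_sq₀ (norm_nonneg _) (norm_nonneg _)).1 (by linarith)
  · intro h
    refine Matrix.le_iff.2 (PosSemidef.of_dotProduct_mulVec_nonneg ?_ fun x => ?_)
    · exact (isHermitian_one.sub (isHermitian_conjTranspose_mul_self W))
    · rw [key (WithLp.toLp 2 x)]
      have := (sq_le_sq₀ (norm_nonneg _) (norm_nonneg _)).2 (h (WithLp.toLp 2 x))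
      exact_mod_cast sub_nonneg.2 this

/-- Douglas' factorization lemma. -/
lemma exists_contraction_mul_eq {X Y : Matrix I I ℂ} (h : Xᴴ * X ≤ Yᴴ * Y) :
    ∃ W, IsContraction W ∧ X = W * Y := by
  have hle (v : EuclideanSpace ℂ I) : ‖toEuclideanLin X v‖ ≤ ‖toEuclideanLin Y v‖ := by
    have h1 := (Matrix.le_iff.1 h).dotProduct_mulVec_nonneg v.ofLp
    rw [sub_mulVec, dotProduct_sub, star_dotProduct_gram, star_dotProduct_gram, sub_nonneg] at h1
    exact (sq_le_sq₀ (norm_nonneg _) (norm_nonneg _)).1 (by exact_mod_cast h1)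
  set x := toEuclideanLin X
  set y := toEuclideanLin Y
  obtain ⟨g, hg⟩ := y.rangeRestrict.exists_rightInverse_of_surjective y.range_rangeRestrict
  have hyg (w : LinearMap.range y) : y (g w) = w := congrArg Subtype.val (LinearMap.congr_fun hg w)
  let w : EuclideanSpace ℂ I →ₗ[ℂ] EuclideanSpace ℂ I :=
    -- The map `y v ↦ x v`, extended by zero to the orthogonal complement of the range. The choice
    -- of preimage `g` is harmless because `‖x u‖ ≤ ‖y u‖` forces `x` to vanish on `ker y`.
    x ∘ₗ g ∘ₗ (LinearMap.range y).orthogonalProjectionOnto.toLinearMap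
  have hw : w ∘ₗ y = x := by
    ext1 v
    have h1 : (LinearMap.range y).orthogonalProjectionOnto (y v) = ⟨y v, v, rfl⟩ :=
      Submodule.orthogonalProjectionOnto_mem_subspace_eq_self (K := LinearMap.range y) ⟨y v, v, rfl⟩
    have h2 : y (g ⟨y v, v, rfl⟩ - v) = 0 := by rw [map_sub, hyg, sub_self]
    have h3 : x (g ⟨y v, v, rfl⟩ - v) = 0 := by
      have := hle (g ⟨y v, v, rfl⟩ - v)
      rw [h2, norm_zero] at this
      exact norm_le_zero_iff.1 this
    rw [map_sub, sub_eq_zero] at h3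
    simp only [w, LinearMap.comp_apply, ContinuousLinearMap.coe_coe, h1, h3]
  refine ⟨toEuclideanLin.symm w, isContraction_iff_norm.2 fun v => ?_, ?_⟩
  · rw [LinearEquiv.apply_symm_apply]
    refine (hle _).trans ?_
    rw [LinearMap.comp_apply, hyg]
    exact (LinearMap.range y).norm_orthogonalProjectionOnto_apply_le v
  · apply toEuclideanLin.injective
    ext1 v
    have := LinearMap.congr_fun hw v
    rw [← LinearEquiv.apply_symm_apply toEuclideanLin w] at this
    simp only [x, y, LinearMap.comp_apply] at this
    rw [← this]
    ext i
    simp [toLpLin_apply]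

lemma IsContraction.conjTranspose {W : Matrix I I ℂ} (hW : IsContraction W) :
    IsContraction Wᴴ := by
  have h1 : ‖(toEuclideanCLM (𝕜 := ℂ) W)‖ ≤ 1 := by
    refine ContinuousLinearMap.opNorm_le_bound _ zero_le_one fun v => ?_
    rw [one_mul]
    exact isContraction_iff_norm.1 hW v
  rw [isContraction_iff_norm]
  intro v
  have h2 : ‖(toEuclideanCLM (𝕜 := ℂ) Wᴴ)‖ ≤ 1 := by
    rw [← star_eq_conjTranspose, map_star, norm_star]; exact h1
  have := (toEuclideanCLM (𝕜 := ℂ) Wᴴ).le_of_opNorm_le h2 v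
  rw [one_mul] at this
  exact this

lemma sqrt_conjTranspose (ρ : Matrix I I ℂ) : (CFC.sqrt ρ)ᴴ = CFC.sqrt ρ :=
  (Matrix.nonneg_iff_posSemidef.1 (CFC.sqrt_nonneg ρ)).isHermitian

lemma hsNorm_sqrt_sq {ρ : Matrix I I ℂ} (hρ : 0 ≤ ρ) : hsNorm (CFC.sqrt ρ) ^ 2 = ρ.trace.re := by
  rw [hsNorm_sq, sqrt_conjTranspose, CFC.sqrt_mul_sqrt_self ρ]

/-- The trace norm `tr |X|`. -/
def trNorm (X : Matrix I I ℂ) : ℝ := (CFC.abs X).trace.re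

lemma abs_conjTranspose_eq (X : Matrix I I ℂ) : (CFC.abs X)ᴴ = CFC.abs X :=
  sqrt_conjTranspose _

lemma abs_mul_abs (X : Matrix I I ℂ) : CFC.abs X * CFC.abs X = Xᴴ * X := CFC.abs_mul_abs X

/-- Since `|X|ᴴ |X| = Xᴴ X`, Douglas' lemma gives `|X| = W X`. With `norm_trace_contraction_mul_le`
this is the duality between the trace norm and contractions, with no need for a unitary polar
decomposition. -/
lemma exists_contraction_trace_eq (X : Matrix I I ℂ) :
    ∃ W, IsContraction W ∧ (W * X).trace.re = trNorm X := by
  obtain ⟨W, hW, h⟩ := exists_contraction_mul_eq (X := CFC.abs X) (Y := X)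
    (by rw [abs_conjTranspose_eq, abs_mul_abs])
  exact ⟨W, hW, by rw [← h, trNorm]⟩

lemma trNorm_le_mul (M N : Matrix I I ℂ) : trNorm (M * N) ≤ hsNorm M * hsNorm N := by
  obtain ⟨W, hW, h⟩ := exists_contraction_trace_eq (M * N)
  rw [← h, ← mul_assoc]
  calc ((W * M) * N).trace.re ≤ ‖(((W * M)ᴴ)ᴴ * N).trace‖ := by
        rw [conjTranspose_conjTranspose]; exact Complex.re_le_norm _
    _ ≤ hsNorm (W * M) * hsNorm N := by
        rw [← hsNorm_conjTranspose (W * M)]; exact norm_trace_le _ _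
    _ ≤ _ := by gcongr; exacts [hsNorm_nonneg _, hsNorm_contraction_mul hW _]

/-- Write `X = V |X|` and split `|X| = S S`: then `tr (W X) = tr (S (W V S))`, and Cauchy–Schwarz
gives `‖S‖₂² = tr |X|`. -/
lemma norm_trace_contraction_mul_le {W : Matrix I I ℂ} (hW : IsContraction W)
    (X : Matrix I I ℂ) : ‖(W * X).trace‖ ≤ trNorm X := by
  obtain ⟨V, hV, h⟩ := exists_contraction_mul_eq (X := X) (Y := CFC.abs X)
    (by rw [abs_conjTranspose_eq, abs_mul_abs])
  set S := CFC.sqrt (CFC.abs X) with hS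
  have hSS : S * S = CFC.abs X := CFC.sqrt_mul_sqrt_self _ (CFC.abs_nonneg X)
  have h1 : (W * X).trace = (Sᴴ * (W * V * S)).trace := by
    rw [hS, sqrt_conjTranspose, ← hS, trace_mul_comm S, mul_assoc, hSS, mul_assoc, ← h]
  have h2 : hsNorm S ^ 2 = trNorm X := hsNorm_sqrt_sq (CFC.abs_nonneg X)
  rw [h1, ← h2, sq]
  refine (norm_trace_le _ _).trans ?_
  gcongr
  exacts [hsNorm_nonneg _, hsNorm_contraction_mul (hW.mul hV) _]

lemma trNorm_contraction_mul_le {W : Matrix I I ℂ} (hW : IsContraction W) (X : Matrix I I ℂ) :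
    trNorm (W * X) ≤ trNorm X := by
  obtain ⟨V, hV, h⟩ := exists_contraction_trace_eq (W * X)
  rw [← h, ← mul_assoc]
  exact (Complex.re_le_norm _).trans (norm_trace_contraction_mul_le (hV.mul hW) X)

lemma trNorm_mul_contraction_le {W : Matrix I I ℂ} (hW : IsContraction W) (X : Matrix I I ℂ) :
    trNorm (X * W) ≤ trNorm X := by
  obtain ⟨V, hV, h⟩ := exists_contraction_trace_eq (X * W)
  rw [← h, ← mul_assoc, trace_mul_comm, ← mul_assoc]
  exact (Complex.re_le_norm _).trans (norm_trace_contraction_mul_le (hW.mul hV) X)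

lemma trNorm_add_le (X Y : Matrix I I ℂ) : trNorm (X + Y) ≤ trNorm X + trNorm Y := by
  obtain ⟨V, hV, h⟩ := exists_contraction_trace_eq (X + Y)
  rw [← h, mul_add, trace_add, Complex.add_re]
  exact add_le_add ((Complex.re_le_norm _).trans (norm_trace_contraction_mul_le hV X))
    ((Complex.re_le_norm _).trans (norm_trace_contraction_mul_le hV Y))

lemma trNorm_smul_le {c : ℝ} (hc : 0 ≤ c) (X : Matrix I I ℂ) : trNorm (c • X) ≤ c * trNorm X := by
  obtain ⟨V, hV, h⟩ := exists_contraction_trace_eq (c • X)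
  rw [← h, mul_smul_comm, trace_smul, Complex.smul_re, smul_eq_mul]
  gcongr
  exact (Complex.re_le_norm _).trans (norm_trace_contraction_mul_le hV X)

lemma trace_re_le_trNorm (X : Matrix I I ℂ) : X.trace.re ≤ trNorm X := by
  have := norm_trace_contraction_mul_le isContraction_one X
  rw [one_mul] at this
  exact (Complex.re_le_norm _).trans this

lemma trNorm_nonneg (X : Matrix I I ℂ) : 0 ≤ trNorm X := trace_re_nonneg (CFC.abs_nonneg X)

lemma sqrtFidelity_eq (ρ τ : Matrix I I ℂ) :
    sqrtFidelity ρ τ = trNorm (CFC.sqrt ρ * CFC.sqrt τ) := rfl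

lemma sqrtFidelity_nonneg (ρ τ : Matrix I I ℂ) : 0 ≤ sqrtFidelity ρ τ := trNorm_nonneg _

/-- Douglas' lemma gives `Mᴴ = W √ρ` and `N = √τ Vᴴ`, and contractions on either side do not
increase the trace norm. Together with its converse below, it allows any factor `M` to stand in for
a square root, so `√(L ρ Lᴴ)` never has to be computed. -/
lemma trNorm_le_sqrtFidelity {ρ τ M N : Matrix I I ℂ} (hρ : 0 ≤ ρ) (hτ : 0 ≤ τ)
    (hM : M * Mᴴ ≤ ρ) (hN : N * Nᴴ ≤ τ) : trNorm (Mᴴ * N) ≤ sqrtFidelity ρ τ := by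
  obtain ⟨W, hW, h⟩ := exists_contraction_mul_eq (X := Mᴴ) (Y := CFC.sqrt ρ)
    (by rwa [conjTranspose_conjTranspose, sqrt_conjTranspose, CFC.sqrt_mul_sqrt_self ρ])
  obtain ⟨V, hV, h'⟩ := exists_contraction_mul_eq (X := Nᴴ) (Y := CFC.sqrt τ)
    (by rwa [conjTranspose_conjTranspose, sqrt_conjTranspose, CFC.sqrt_mul_sqrt_self τ])
  have h'' : N = CFC.sqrt τ * Vᴴ := by
    rw [← conjTranspose_conjTranspose N, h', conjTranspose_mul, sqrt_conjTranspose]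
  rw [h, h'', sqrtFidelity_eq, mul_assoc, ← mul_assoc (CFC.sqrt ρ)]
  exact (trNorm_contraction_mul_le hW _).trans (trNorm_mul_contraction_le hV.conjTranspose _)

lemma sqrtFidelity_le_trNorm {ρ τ M N : Matrix I I ℂ} (hρ : 0 ≤ ρ) (hτ : 0 ≤ τ)
    (hM : ρ ≤ M * Mᴴ) (hN : τ ≤ N * Nᴴ) : sqrtFidelity ρ τ ≤ trNorm (Mᴴ * N) := by
  obtain ⟨W, hW, h⟩ := exists_contraction_mul_eq (X := CFC.sqrt ρ) (Y := Mᴴ)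
    (by rwa [conjTranspose_conjTranspose, sqrt_conjTranspose, CFC.sqrt_mul_sqrt_self ρ])
  obtain ⟨V, hV, h'⟩ := exists_contraction_mul_eq (X := CFC.sqrt τ) (Y := Nᴴ)
    (by rwa [conjTranspose_conjTranspose, sqrt_conjTranspose, CFC.sqrt_mul_sqrt_self τ])
  have h'' : CFC.sqrt τ = N * Vᴴ := by
    rw [← sqrt_conjTranspose, h', conjTranspose_mul, conjTranspose_conjTranspose]
  rw [sqrtFidelity_eq, h, h'', mul_assoc, ← mul_assoc Mᴴ]
  exact (trNorm_contraction_mul_le hW _).trans (trNorm_mul_contraction_le hV.conjTranspose _)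

lemma sqrt_mul_conjTranspose {ρ : Matrix I I ℂ} (hρ : 0 ≤ ρ) (K : Matrix I I ℂ) :
    K * CFC.sqrt ρ * (K * CFC.sqrt ρ)ᴴ = K * ρ * Kᴴ := by
  rw [conjTranspose_mul, sqrt_conjTranspose]
  conv_rhs => rw [← CFC.sqrt_mul_sqrt_self ρ hρ]
  simp only [mul_assoc]

/-- Conjugating `ρ` by `L` costs at most `‖(1 - L) √ρ‖₂` in root fidelity. -/
lemma sqrtFidelity_le_conj_add {ρ τ : Matrix I I ℂ} (hτ : 0 ≤ τ)
    (hτ1 : τ.trace.re ≤ 1) (L : Matrix I I ℂ) :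
    sqrtFidelity τ ρ ≤ trNorm (CFC.sqrt τ * (L * CFC.sqrt ρ)) + hsNorm ((1 - L) * CFC.sqrt ρ) := by
  have h1 : hsNorm (CFC.sqrt τ) ≤ 1 := by
    rw [← sq_le_one_iff₀ (hsNorm_nonneg _), hsNorm_sqrt_sq hτ]; exact hτ1
  have h2 : CFC.sqrt τ * CFC.sqrt ρ
      = CFC.sqrt τ * (L * CFC.sqrt ρ) + CFC.sqrt τ * ((1 - L) * CFC.sqrt ρ) := by noncomm_ring
  rw [sqrtFidelity_eq, h2]
  refine (trNorm_add_le _ _).trans ?_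
  gcongr
  refine (trNorm_le_mul _ _).trans ?_
  exact mul_le_of_le_one_left (hsNorm_nonneg _) h1

lemma isSubnormalized_conj {ρ L : Matrix I I ℂ} (hρ : IsState ρ) (hL : IsContraction L) :
    IsSubnormalized (L * ρ * Lᴴ) := by
  have hρ0 : 0 ≤ ρ := Matrix.nonneg_iff_posSemidef.2 hρ.1
  refine ⟨hρ.1.mul_mul_conjTranspose_same L, ?_⟩
  have h := hsNorm_contraction_mul hL (CFC.sqrt ρ)
  rw [← sq_le_sq₀ (hsNorm_nonneg _) (hsNorm_nonneg _), hsNorm_sqrt_sq hρ0, hsNorm_sq,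
    trace_mul_comm, sqrt_mul_conjTranspose hρ0, hρ.2] at h
  simpa using h

lemma hsNorm_sqrt_of_isState {ρ : Matrix I I ℂ} (hρ : IsState ρ) : hsNorm (CFC.sqrt ρ) = 1 := by
  have := hsNorm_sqrt_sq (Matrix.nonneg_iff_posSemidef.2 hρ.1)
  rw [hρ.2, Complex.one_re] at this
  have h0 := hsNorm_nonneg (CFC.sqrt ρ)
  nlinarith

lemma purifiedDistance_le_iff {ρ : Matrix I I ℂ} (hρ : IsState ρ) (τ : Matrix I I ℂ) {ε : ℝ}
    (hε : 0 ≤ ε) : purifiedDistance τ ρ ≤ ε ↔ 1 - ε ^ 2 ≤ sqrtFidelity τ ρ ^ 2 := by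
  rw [purifiedDistance, genFidelity, hρ.2, Real.sqrt_le_left hε]
  simp
  constructor <;> intro h <;> linarith

/-- With `L √ρ` as a factor of `L ρ Lᴴ`, the root fidelity is at least `Re tr ((L √ρ)ᴴ √ρ)`, which
Cauchy–Schwarz bounds below by `1 - ‖(1 - L) √ρ‖₂`. -/
lemma conj_mem_ball {ρ L : Matrix I I ℂ} (hρ : IsState ρ) (hL : IsContraction L) {ε : ℝ}
    (hε : 0 ≤ ε) (h : hsNorm ((1 - L) * CFC.sqrt ρ) ≤ 1 - √(1 - ε ^ 2)) :
    L * ρ * Lᴴ ∈ ball ε ρ := by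
  have hρ0 : 0 ≤ ρ := Matrix.nonneg_iff_posSemidef.2 hρ.1
  have hs := isSubnormalized_conj hρ hL
  refine ⟨hs, (purifiedDistance_le_iff hρ _ hε).2 ?_⟩
  have h1 : trNorm ((L * CFC.sqrt ρ)ᴴ * CFC.sqrt ρ) ≤ sqrtFidelity (L * ρ * Lᴴ) ρ :=
    trNorm_le_sqrtFidelity (Matrix.nonneg_iff_posSemidef.2 hs.1) hρ0
      (sqrt_mul_conjTranspose hρ0 L).le (by rw [sqrt_conjTranspose, CFC.sqrt_mul_sqrt_self ρ])
  have hn := hsNorm_sqrt_of_isState hρ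
  have h2 : ((L * CFC.sqrt ρ)ᴴ * CFC.sqrt ρ).trace
      = ρ.trace - (((1 - L) * CFC.sqrt ρ)ᴴ * CFC.sqrt ρ).trace := by
    rw [← trace_sub]
    conv_rhs => enter [1, 1]; rw [← CFC.sqrt_mul_sqrt_self ρ hρ0]
    rw [← sub_mul]
    congr 2
    simp [sub_mul, sqrt_conjTranspose]
  have h3 := (Complex.re_le_norm _).trans
    (norm_trace_le ((1 - L) * CFC.sqrt ρ) (CFC.sqrt ρ))
  have h4 := trace_re_le_trNorm ((L * CFC.sqrt ρ)ᴴ * CFC.sqrt ρ)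
  rw [h2, hρ.2, Complex.sub_re, Complex.one_re] at h4
  rw [hn, mul_one] at h3
  have h5 : √(1 - ε ^ 2) ≤ sqrtFidelity (L * ρ * Lᴴ) ρ := by linarith
  exact (Real.sqrt_le_iff.1 h5).2

lemma sqrt_le_of_mem_ball {ρ τ : Matrix I I ℂ} (hρ : IsState ρ) {ε : ℝ} (hε : 0 ≤ ε)
    (h : τ ∈ ball ε ρ) : √(1 - ε ^ 2) ≤ sqrtFidelity τ ρ :=
  Real.sqrt_le_iff.2 ⟨sqrtFidelity_nonneg _ _, (purifiedDistance_le_iff hρ τ hε).1 h.2⟩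

lemma self_mem_ball {ρ : Matrix I I ℂ} (hρ : IsState ρ) {ε : ℝ} (hε : 0 ≤ ε) : ρ ∈ ball ε ρ := by
  have := conj_mem_ball hρ isContraction_one hε (by
    have h0 : hsNorm (0 : Matrix I I ℂ) = 0 := by
      rw [← sq_eq_zero_iff, hsNorm_sq]; simp
    rw [sub_self, zero_mul, h0, sub_nonneg]
    exact Real.sqrt_le_one.2 (by nlinarith))
  simpa using this

/-- Equality in Cauchy–Schwarz: if `W` attains the fidelity, `X = √τ Wᴴ` has norm at most `1` and
inner product at least `1` with the unit vector `√ρ`, so `X = √ρ`. Hence `ρ = X Xᴴ ≤ τ`, and `tr τ ≤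
1` leaves no room for a difference. -/
lemma ball_zero {ρ : Matrix I I ℂ} (hρ : IsState ρ) : ball 0 ρ = {ρ} := by
  refine Set.eq_singleton_iff_unique_mem.2 ⟨self_mem_ball hρ le_rfl, fun τ hτ => ?_⟩
  have hρ0 : 0 ≤ ρ := Matrix.nonneg_iff_posSemidef.2 hρ.1
  have hτ0 : 0 ≤ τ := Matrix.nonneg_iff_posSemidef.2 hτ.1.1
  have h1 := sqrt_le_of_mem_ball hρ le_rfl hτ
  norm_num at h1
  obtain ⟨W, hW, h⟩ := exists_contraction_trace_eq (CFC.sqrt τ * CFC.sqrt ρ)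
  rw [← sqrtFidelity_eq] at h
  set X := CFC.sqrt τ * Wᴴ with hX
  have hXX : X * Xᴴ ≤ τ := by
    rw [hX, conjTranspose_mul, conjTranspose_conjTranspose, sqrt_conjTranspose]
    have := conj_le_conj hW (CFC.sqrt τ)
    rw [mul_one, sqrt_conjTranspose, CFC.sqrt_mul_sqrt_self τ] at this
    simpa only [mul_assoc] using this
  have hXn : hsNorm X ^ 2 ≤ 1 := by
    rw [← hsNorm_conjTranspose, hsNorm_sq, conjTranspose_conjTranspose]
    exact (trace_re_mono hXX).trans hτ.1.2
  have hXρ : X = CFC.sqrt ρ := by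
    have hd := norm_sub_sq (𝕜 := ℂ) (vec X) (vec (CFC.sqrt ρ))
    have h2 : (inner ℂ (vec X) (vec (CFC.sqrt ρ))).re = sqrtFidelity τ ρ := by
      rw [inner_vec, hX, conjTranspose_mul, conjTranspose_conjTranspose, sqrt_conjTranspose,
        mul_assoc, h]
    change _ = hsNorm X ^ 2 - 2 * (inner ℂ (vec X) (vec (CFC.sqrt ρ))).re
      + hsNorm (CFC.sqrt ρ) ^ 2 at hd
    rw [h2, hsNorm_sqrt_of_isState hρ] at hd
    have h3 : ‖vec X - vec (CFC.sqrt ρ)‖ = 0 := by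
      rw [← sq_eq_zero_iff]
      exact le_antisymm (by linarith) (sq_nonneg _)
    rw [norm_eq_zero, sub_eq_zero] at h3
    ext i j
    exact congrArg (fun v => v.ofLp (i, j)) h3
  rw [hXρ, sqrt_conjTranspose, CFC.sqrt_mul_sqrt_self ρ] at hXX
  have h4 : CFC.sqrt (τ - ρ) = 0 := by
    have h5 := hsNorm_sqrt_sq (sub_nonneg.2 hXX)
    rw [trace_sub, Complex.sub_re, hρ.2, Complex.one_re] at h5
    have h6 : hsNorm (CFC.sqrt (τ - ρ)) = 0 := by
      rw [← sq_eq_zero_iff]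
      exact le_antisymm (by linarith [hτ.1.2]) (sq_nonneg _)
    have h7 := norm_eq_zero.1 h6
    ext i j
    exact congrArg (fun v => v.ofLp (i, j)) h7
  exact sub_eq_zero.1 ((CFC.sqrt_eq_zero_iff _ (sub_nonneg.2 hXX)).1 h4)

end TraceNorm

/-! ### One-shot estimates for the filter `(1 ⊗ Q) P` -/

section OneShot

lemma IsState.nonneg {I : Type*} [Fintype I] {ρ : Matrix I I ℂ} (h : IsState ρ) : 0 ≤ ρ :=
  Matrix.nonneg_iff_posSemidef.2 h.1

lemma IsSubnormalized.nonneg {I : Type*} [Fintype I] {ρ : Matrix I I ℂ}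
    (h : IsSubnormalized ρ) : 0 ≤ ρ :=
  Matrix.nonneg_iff_posSemidef.2 h.1

lemma IsState.isSubnormalized {I : Type*} [Fintype I] {ρ : Matrix I I ℂ} (h : IsState ρ) :
    IsSubnormalized ρ :=
  ⟨h.1, by simp [h.2]⟩

variable {I : Type*} [Fintype I] [DecidableEq I]

lemma hsNorm_mul_sqrt_sq {ρ : Matrix I I ℂ} (hρ : 0 ≤ ρ) (K : Matrix I I ℂ) :
    hsNorm (K * CFC.sqrt ρ) ^ 2 = (Kᴴ * K * ρ).trace.re := by
  rw [hsNorm_sq, trace_mul_comm, sqrt_mul_conjTranspose hρ, trace_mul_comm, mul_assoc]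

lemma trace_mul_re_nonneg {X ρ : Matrix I I ℂ} (hX : 0 ≤ X) (hρ : 0 ≤ ρ) :
    0 ≤ (X * ρ).trace.re := by
  have := hsNorm_mul_sqrt_sq hρ (CFC.sqrt X)
  rw [sqrt_conjTranspose, CFC.sqrt_mul_sqrt_self X] at this
  rw [← this]
  positivity

lemma trace_mul_re_mono {X Y ρ : Matrix I I ℂ} (h : X ≤ Y) (hρ : 0 ≤ ρ) :
    (X * ρ).trace.re ≤ (Y * ρ).trace.re := by
  have := trace_mul_re_nonneg (sub_nonneg.2 h) hρ
  rw [sub_mul, trace_sub, Complex.sub_re] at this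
  linarith

lemma smul_mono_left {c : ℝ} (hc : 0 ≤ c) {X Y : Matrix I I ℂ} (h : X ≤ Y) : c • X ≤ c • Y := by
  rw [Matrix.le_iff, ← smul_sub]
  exact (Matrix.le_iff.1 h).smul hc

variable {P : Matrix I I ℂ}

lemma _root_.IsStarProjection.conjTranspose_eq (hP : IsStarProjection P) : Pᴴ = P :=
  hP.isSelfAdjoint

lemma _root_.IsStarProjection.isContraction (hP : IsStarProjection P) : IsContraction P := by
  rw [IsContraction, hP.conjTranspose_eq, hP.isIdempotentElem.eq]
  exact hP.le_one

lemma hsNorm_one_sub_mul_sqrt (hP : IsStarProjection P) {ρ : Matrix I I ℂ} (hρ : 0 ≤ ρ) :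
    hsNorm ((1 - P) * CFC.sqrt ρ) = √((1 - P) * ρ).trace.re := by
  have h := hsNorm_mul_sqrt_sq hρ (1 - P)
  rw [hP.one_sub.conjTranspose_eq, hP.one_sub.isIdempotentElem.eq] at h
  rw [← h, Real.sqrt_sq (hsNorm_nonneg _)]

variable {A B : Type*} [Fintype A] [DecidableEq A] [Fintype B] [DecidableEq B]

/-- The partial trace is dual to `Y ↦ 1 ⊗ Y`; this is how `ρ_B` enters the estimates on `AB`. -/
lemma trace_mul_one_kronecker (X : Matrix (A × B) (A × B) ℂ) (Y : Matrix B B ℂ) :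
    (X * ((1 : Matrix A A ℂ) ⊗ₖ Y)).trace = (marginalRight X * Y).trace := by
  simp only [trace, diag_apply, mul_apply, marginalRight, of_apply, kroneckerMap_apply,
    Fintype.sum_prod_type, one_apply, Finset.sum_mul, ite_mul, one_mul, zero_mul, mul_ite, mul_zero]
  rw [Finset.sum_comm]
  refine Finset.sum_congr rfl fun y _ => ?_
  rw [Finset.sum_comm]
  conv_rhs => rw [Finset.sum_comm]
  refine Finset.sum_congr rfl fun x _ => ?_
  rw [Finset.sum_comm]
  simp

lemma trace_marginalRight (X : Matrix (A × B) (A × B) ℂ) :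
    (marginalRight X).trace = X.trace := by
  simp only [trace, diag_apply, marginalRight, of_apply, Fintype.sum_prod_type]
  rw [Finset.sum_comm]

lemma isState_marginalRight {ρ : Matrix (A × B) (A × B) ℂ} (hρ : IsState ρ) :
    IsState (marginalRight ρ) := by
  refine ⟨?_, by rw [trace_marginalRight, hρ.2]⟩
  have : marginalRight ρ = ∑ x : A, ρ.submatrix (fun y => (x, y)) (fun y => (x, y)) := by
    ext y y'
    simp [marginalRight, Matrix.sum_apply]
  rw [this]
  exact posSemidef_sum _ fun x _ => hρ.1.submatrix _

lemma one_kronecker_mul (X Y : Matrix B B ℂ) :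
    ((1 : Matrix A A ℂ) ⊗ₖ X) * ((1 : Matrix A A ℂ) ⊗ₖ Y) = (1 : Matrix A A ℂ) ⊗ₖ (X * Y) := by
  rw [← mul_kronecker_mul, one_mul]

lemma one_kronecker_conjTranspose (X : Matrix B B ℂ) :
    ((1 : Matrix A A ℂ) ⊗ₖ X)ᴴ = (1 : Matrix A A ℂ) ⊗ₖ Xᴴ := by
  rw [conjTranspose_kronecker, conjTranspose_one]

lemma one_kronecker_mono {X Y : Matrix B B ℂ} (h : X ≤ Y) :
    (1 : Matrix A A ℂ) ⊗ₖ X ≤ (1 : Matrix A A ℂ) ⊗ₖ Y := by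
  rw [Matrix.le_iff]
  have := (PosSemidef.one (n := A) (R := ℂ)).kronecker (Matrix.le_iff.1 h)
  convert this using 1
  ext p q
  simp [kroneckerMap_apply, mul_sub]

lemma one_kronecker_nonneg {X : Matrix B B ℂ} (h : 0 ≤ X) : 0 ≤ (1 : Matrix A A ℂ) ⊗ₖ X := by
  simpa using one_kronecker_mono (A := A) h

lemma isStarProjection_one_kronecker {Q : Matrix B B ℂ} (hQ : IsStarProjection Q) :
    IsStarProjection ((1 : Matrix A A ℂ) ⊗ₖ Q) where
  isIdempotentElem := by
    rw [IsIdempotentElem, one_kronecker_mul, hQ.isIdempotentElem.eq]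
  isSelfAdjoint := by
    rw [IsSelfAdjoint, star_eq_conjTranspose, one_kronecker_conjTranspose, hQ.conjTranspose_eq]

variable {P : Matrix (A × B) (A × B) ℂ} {Q : Matrix B B ℂ} {ρ τ : Matrix (A × B) (A × B) ℂ}

/-- The product of a projection on `B` and a projection on `AB`. -/
def filterOp (P : Matrix (A × B) (A × B) ℂ) (Q : Matrix B B ℂ) : Matrix (A × B) (A × B) ℂ :=
  ((1 : Matrix A A ℂ) ⊗ₖ Q) * P

/-- An upper bound on `‖(1 - filterOp P Q) √ρ‖₂`. -/
def filterDefect (P : Matrix (A × B) (A × B) ℂ) (Q : Matrix B B ℂ)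
    (ρ : Matrix (A × B) (A × B) ℂ) : ℝ :=
  √((1 - P) * ρ).trace.re + √((1 - Q) * marginalRight ρ).trace.re

lemma isContraction_filterOp (hP : IsStarProjection P) (hQ : IsStarProjection Q) :
    IsContraction (filterOp P Q) :=
  (isStarProjection_one_kronecker hQ).isContraction.mul hP.isContraction

lemma hsNorm_one_sub_filterOp (hP : IsStarProjection P) (hQ : IsStarProjection Q) (hρ : 0 ≤ ρ) :
    hsNorm ((1 - filterOp P Q) * CFC.sqrt ρ) ≤ filterDefect P Q ρ := by
  have hQ' := isStarProjection_one_kronecker (A := A) hQ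
  -- The splitting `1 - QP = Q (1 - P) + (1 - Q)` lets the two projections be treated separately
  -- although they need not commute.
  have h : (1 - filterOp P Q) * CFC.sqrt ρ = ((1 : Matrix A A ℂ) ⊗ₖ Q) * ((1 - P) * CFC.sqrt ρ)
      + (1 - (1 : Matrix A A ℂ) ⊗ₖ Q) * CFC.sqrt ρ := by
    rw [filterOp]; noncomm_ring
  rw [h]
  refine (hsNorm_add_le _ _).trans (add_le_add ?_ ?_)
  · rw [← hsNorm_one_sub_mul_sqrt hP hρ]
    exact hsNorm_contraction_mul hQ'.isContraction _
  · rw [hsNorm_one_sub_mul_sqrt hQ' hρ]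
    apply le_of_eq
    congr 2
    rw [trace_mul_comm, mul_sub, trace_sub, mul_one, trace_mul_one_kronecker, sub_mul, trace_sub,
      one_mul, trace_marginalRight, trace_mul_comm Q]

lemma filterOp_conj_le (hP : IsStarProjection P) (hQ : IsStarProjection Q) {μ θ : ℝ} (hμ : 0 ≤ μ)
    (h1 : P * ρ * P ≤ μ • 1) (h2 : Q ≤ θ • marginalRight ρ) :
    filterOp P Q * ρ * (filterOp P Q)ᴴ ≤ (μ * θ) • ((1 : Matrix A A ℂ) ⊗ₖ marginalRight ρ) := by
  have h3 := conj_le_conj' h1 ((1 : Matrix A A ℂ) ⊗ₖ Q)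
  have h4 := smul_mono_left hμ (one_kronecker_mono (A := A) h2)
  rw [mul_smul_comm, mul_one, smul_mul_assoc, one_kronecker_conjTranspose, one_kronecker_mul,
    hQ.conjTranspose_eq, hQ.isIdempotentElem.eq] at h3
  rw [kronecker_smul, smul_smul] at h4
  refine le_trans (le_of_eq ?_) (h3.trans h4)
  rw [filterOp, conjTranspose_mul, hP.conjTranspose_eq, one_kronecker_conjTranspose,
    hQ.conjTranspose_eq]
  simp only [mul_assoc]

/-- The trace equals `tr (P (1 ⊗ QσQ))`. Replacing `P` by `θ ρ` brings in the partial trace and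
leaves `θ tr (Q ρ_B Q σ)`, which is at most `θ μ tr σ`. -/
lemma trace_filterOp_le (hP : IsStarProjection P) (hQ : IsStarProjection Q) {μ θ : ℝ}
    (hμ : 0 ≤ μ) (hθ : 0 ≤ θ) (h1 : P ≤ θ • ρ) (h2 : Q * marginalRight ρ * Q ≤ μ • 1)
    {σ : Matrix B B ℂ} (hσ : IsSubnormalized σ) :
    (filterOp P Q * (filterOp P Q)ᴴ * ((1 : Matrix A A ℂ) ⊗ₖ σ)).trace.re ≤ θ * μ := by
  have h3 : (filterOp P Q * (filterOp P Q)ᴴ * ((1 : Matrix A A ℂ) ⊗ₖ σ)).trace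
      = (P * ((1 : Matrix A A ℂ) ⊗ₖ (Q * σ * Q))).trace := by
    rw [filterOp, conjTranspose_mul, hP.conjTranspose_eq, one_kronecker_conjTranspose,
      hQ.conjTranspose_eq, ← one_kronecker_mul, ← one_kronecker_mul]
    calc _ = ((1 : Matrix A A ℂ) ⊗ₖ Q * ((P * P) * (1 : Matrix A A ℂ) ⊗ₖ Q
              * (1 : Matrix A A ℂ) ⊗ₖ σ)).trace := by simp only [mul_assoc]
      _ = _ := by rw [trace_mul_comm, hP.isIdempotentElem.eq]; simp only [mul_assoc]
  have h4 : 0 ≤ Q * σ * Q := by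
    have := conj_le_conj hσ.nonneg Q
    simpa [hQ.conjTranspose_eq] using this
  have h5 : (marginalRight ρ * (Q * σ * Q)).trace = (Q * marginalRight ρ * Q * σ).trace := by
    rw [← mul_assoc, trace_mul_comm]; simp only [mul_assoc]
  rw [h3]
  refine (trace_mul_re_mono h1 (one_kronecker_nonneg h4)).trans ?_
  rw [smul_mul_assoc, trace_smul, Complex.smul_re, smul_eq_mul, trace_mul_one_kronecker, h5]
  gcongr
  refine (trace_mul_re_mono h2 hσ.nonneg).trans ?_
  rw [smul_mul_assoc, one_mul, trace_smul, Complex.smul_re, smul_eq_mul]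
  exact mul_le_of_le_one_right hμ hσ.2

/-- The converse for the min-entropy: after filtering, the fidelity of `τ` with `ρ` is at most `‖Lᴴ
√τ‖₂`, whose square `tr (L Lᴴ τ)` is controlled by `τ ≤ x (1 ⊗ σ)`. -/
lemma sq_le_of_mem_ball (hP : IsStarProjection P) (hQ : IsStarProjection Q) {μ θ ε x : ℝ}
    (hρ : IsState ρ) (hε : 0 ≤ ε)
    (hμ : 0 ≤ μ) (hθ : 0 ≤ θ) (h1 : P ≤ θ • ρ) (h2 : Q * marginalRight ρ * Q ≤ μ • 1)
    (hx : 0 ≤ x) {σ : Matrix B B ℂ} (hσ : IsSubnormalized σ) (hτ : τ ∈ ball ε ρ)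
    (h : τ ≤ x • ((1 : Matrix A A ℂ) ⊗ₖ σ)) (hη : filterDefect P Q ρ ≤ √(1 - ε ^ 2)) :
    (√(1 - ε ^ 2) - filterDefect P Q ρ) ^ 2 ≤ x * (θ * μ) := by
  set L := filterOp P Q
  have h3 := (sqrt_le_of_mem_ball hρ hε hτ).trans
    (sqrtFidelity_le_conj_add (ρ := ρ) hτ.1.nonneg hτ.1.2 L)
  have h4 := hsNorm_one_sub_filterOp hP hQ hρ.nonneg
  have h5 := trNorm_le_mul (CFC.sqrt τ * L) (CFC.sqrt ρ)
  rw [hsNorm_sqrt_of_isState hρ, mul_one, mul_assoc, ← hsNorm_conjTranspose, conjTranspose_mul,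
    sqrt_conjTranspose] at h5
  calc _ ≤ hsNorm (Lᴴ * CFC.sqrt τ) ^ 2 := by
        apply pow_le_pow_left₀ (sub_nonneg.2 hη)
        linarith
    _ = (L * Lᴴ * τ).trace.re := by
        rw [hsNorm_mul_sqrt_sq hτ.1.nonneg, conjTranspose_conjTranspose]
    _ ≤ (L * Lᴴ * (x • ((1 : Matrix A A ℂ) ⊗ₖ σ))).trace.re := by
        rw [trace_mul_comm, trace_mul_comm (L * Lᴴ)]
        exact trace_mul_re_mono h
          (Matrix.nonneg_iff_posSemidef.2 (posSemidef_self_mul_conjTranspose L))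
    _ = x * (L * Lᴴ * ((1 : Matrix A A ℂ) ⊗ₖ σ)).trace.re := by
        rw [mul_smul_comm, trace_smul, Complex.smul_re, smul_eq_mul]
    _ ≤ _ := by gcongr; exact trace_filterOp_le hP hQ hμ hθ h1 h2 hσ

/-- The converse for the max-entropy, with `σ = ρ_B`: the rescaled `L √ρ / √(μθ)` is a factor of an
operator below `1 ⊗ ρ_B`, so `trNorm_le_sqrtFidelity` applies. -/
lemma sqrt_sub_le_of_mem_ball (hP : IsStarProjection P) (hQ : IsStarProjection Q) {μ θ ε : ℝ}
    (hρ : IsState ρ) (hε : 0 ≤ ε)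
    (hμ : 0 < μ) (hθ : 0 < θ) (h1 : P * ρ * P ≤ μ • 1) (h2 : Q ≤ θ • marginalRight ρ)
    (hτ : τ ∈ ball ε ρ) :
    √(1 - ε ^ 2) - filterDefect P Q ρ
      ≤ √(μ * θ) * sqrtFidelity τ ((1 : Matrix A A ℂ) ⊗ₖ marginalRight ρ) := by
  set L := filterOp P Q
  have h3 := (sqrt_le_of_mem_ball hρ hε hτ).trans
    (sqrtFidelity_le_conj_add (ρ := ρ) hτ.1.nonneg hτ.1.2 L)
  have h4 := hsNorm_one_sub_filterOp hP hQ hρ.nonneg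
  have hs : 0 < √(μ * θ) := Real.sqrt_pos.2 (mul_pos hμ hθ)
  have h5 : CFC.sqrt τ * (L * CFC.sqrt ρ)
      = √(μ * θ) • ((CFC.sqrt τ)ᴴ * ((√(μ * θ))⁻¹ • (L * CFC.sqrt ρ))) := by
    rw [mul_smul_comm, smul_smul, mul_inv_cancel₀ hs.ne', one_smul, sqrt_conjTranspose]
  have h6 := trNorm_smul_le hs.le ((CFC.sqrt τ)ᴴ * ((√(μ * θ))⁻¹ • (L * CFC.sqrt ρ)))
  rw [← h5] at h6
  have h7 : trNorm ((CFC.sqrt τ)ᴴ * ((√(μ * θ))⁻¹ • (L * CFC.sqrt ρ)))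
      ≤ sqrtFidelity τ ((1 : Matrix A A ℂ) ⊗ₖ marginalRight ρ) := by
    refine trNorm_le_sqrtFidelity hτ.1.nonneg
      (one_kronecker_nonneg (isState_marginalRight hρ).nonneg) ?_ ?_
    · rw [sqrt_conjTranspose, CFC.sqrt_mul_sqrt_self τ hτ.1.nonneg]
    · rw [conjTranspose_smul, smul_mul_smul_comm, sqrt_mul_conjTranspose hρ.nonneg]
      have := smul_mono_left (inv_pos.2 (mul_pos hμ hθ)).le (filterOp_conj_le hP hQ hμ.le h1 h2)
      rw [smul_smul, inv_mul_cancel₀ (mul_pos hμ hθ).ne', one_smul] at this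
      rwa [star_trivial, ← mul_inv, Real.mul_self_sqrt (mul_pos hμ hθ).le]
  have h8 := mul_le_mul_of_nonneg_left h7 hs.le
  linarith

lemma fidelity_filterOp_le (hP : IsStarProjection P) (hQ : IsStarProjection Q) {μ θ : ℝ}
    (hρ : IsState ρ)
    (hμ : 0 ≤ μ) (hθ : 0 ≤ θ) (h1 : P ≤ θ • ρ) (h2 : Q * marginalRight ρ * Q ≤ μ • 1)
    {σ : Matrix B B ℂ} (hσ : IsSubnormalized σ) :
    fidelity (filterOp P Q * ρ * (filterOp P Q)ᴴ) ((1 : Matrix A A ℂ) ⊗ₖ σ) ≤ θ * μ := by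
  set L := filterOp P Q
  have hσ' := one_kronecker_nonneg (A := A) hσ.nonneg
  have h3 : sqrtFidelity (L * ρ * Lᴴ) ((1 : Matrix A A ℂ) ⊗ₖ σ)
      ≤ trNorm ((L * CFC.sqrt ρ)ᴴ * CFC.sqrt ((1 : Matrix A A ℂ) ⊗ₖ σ)) :=
    sqrtFidelity_le_trNorm (Matrix.nonneg_iff_posSemidef.2 (hρ.1.mul_mul_conjTranspose_same L)) hσ'
      (sqrt_mul_conjTranspose hρ.nonneg L).ge
      (by rw [sqrt_conjTranspose, CFC.sqrt_mul_sqrt_self _ hσ'])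
  have h4 := trNorm_le_mul (CFC.sqrt ρ) (Lᴴ * CFC.sqrt ((1 : Matrix A A ℂ) ⊗ₖ σ))
  rw [hsNorm_sqrt_of_isState hρ, one_mul, ← mul_assoc] at h4
  rw [conjTranspose_mul, sqrt_conjTranspose] at h3
  calc _ ≤ hsNorm (Lᴴ * CFC.sqrt ((1 : Matrix A A ℂ) ⊗ₖ σ)) ^ 2 :=
        pow_le_pow_left₀ (sqrtFidelity_nonneg _ _) (h3.trans h4) 2
    _ = (L * Lᴴ * ((1 : Matrix A A ℂ) ⊗ₖ σ)).trace.re := by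
        rw [hsNorm_mul_sqrt_sq hσ', conjTranspose_conjTranspose]
    _ ≤ _ := trace_filterOp_le hP hQ hμ hθ h1 h2 hσ

end OneShot

/-! ### One-shot bounds on the smooth entropies -/

section EntropyBounds

variable {A B : Type*} [Fintype A] [DecidableEq A] [Fintype B] [DecidableEq B]
variable {P : Matrix (A × B) (A × B) ℂ} {Q : Matrix B B ℂ} {ρ : Matrix (A × B) (A × B) ℂ}
variable {b ε t s : ℝ}

lemma sqrt_one_sub_sq_pos (hε : 0 ≤ ε) (hε1 : ε < 1) : 0 < √(1 - ε ^ 2) :=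
  Real.sqrt_pos.2 (by nlinarith)

lemma le_smoothMinEntropy (hb : 1 < b) (hρ : IsState ρ) (hε : 0 ≤ ε)
    (hP : IsStarProjection P) (hQ : IsStarProjection Q)
    (h1 : P * ρ * P ≤ (b ^ (-t)) • 1) (h2 : Q ≤ (b ^ s) • marginalRight ρ)
    (h : filterDefect P Q ρ ≤ 1 - √(1 - ε ^ 2)) :
    ((t - s : ℝ) : EReal) ≤ smoothMinEntropy b ε ρ := by
  have hb0 : 0 < b := by linarith
  have h3 := conj_mem_ball hρ (isContraction_filterOp hP hQ) hε
    ((hsNorm_one_sub_filterOp hP hQ hρ.nonneg).trans h)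
  have h4 := filterOp_conj_le hP hQ (Real.rpow_nonneg hb0.le _) h1 h2
  rw [← Real.rpow_add hb0, show -t + s = -(t - s) by ring] at h4
  refine le_iSup₂_of_le _ h3 ?_
  exact le_iSup₂_of_le _ (isState_marginalRight hρ).isSubnormalized (le_iSup₂_of_le _ h4 le_rfl)

lemma smoothMinEntropy_le (hb : 1 < b) (hρ : IsState ρ) (hε : 0 ≤ ε) (hε1 : ε < 1)
    (hP : IsStarProjection P) (hQ : IsStarProjection Q)
    (h1 : P ≤ (b ^ t) • ρ) (h2 : Q * marginalRight ρ * Q ≤ (b ^ (-s)) • 1)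
    (h : filterDefect P Q ρ ≤ √(1 - ε ^ 2) / 2) :
    smoothMinEntropy b ε ρ ≤ ((t - s - Real.logb b ((√(1 - ε ^ 2) / 2) ^ 2) : ℝ) : EReal) := by
  have hb0 : 0 < b := by linarith
  have hc := sqrt_one_sub_sq_pos hε hε1
  refine iSup₂_le fun τ hτ => iSup₂_le fun σ hσ => iSup₂_le fun r hr => ?_
  have h3 := sq_le_of_mem_ball hP hQ hρ hε (Real.rpow_nonneg hb0.le _)
    (Real.rpow_nonneg hb0.le _) h1 h2 (Real.rpow_nonneg hb0.le _) hσ hτ hr (by linarith)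
  rw [← Real.rpow_add hb0, ← Real.rpow_add hb0] at h3
  -- The defect uses up at most half of `√(1 - ε²)`; the remaining half costs an additive constant
  -- that does not grow with the number of copies.
  have h4 : (√(1 - ε ^ 2) / 2) ^ 2 ≤ b ^ (-r + (t + -s)) :=
    le_trans (pow_le_pow_left₀ (by positivity) (by linarith) 2) h3
  have h5 := (Real.logb_le_iff_le_rpow hb (by positivity)).2 h4
  exact_mod_cast (by linarith : r ≤ t - s - Real.logb b ((√(1 - ε ^ 2) / 2) ^ 2))

lemma smoothMaxEntropy_le (hb : 1 < b) (hρ : IsState ρ) (hε : 0 ≤ ε)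
    (hP : IsStarProjection P) (hQ : IsStarProjection Q)
    (h1 : P ≤ (b ^ t) • ρ) (h2 : Q * marginalRight ρ * Q ≤ (b ^ (-s)) • 1)
    (h : filterDefect P Q ρ ≤ 1 - √(1 - ε ^ 2)) :
    smoothMaxEntropy b ε ρ ≤ ((t - s : ℝ) : EReal) := by
  have hb0 : 0 < b := by linarith
  have h3 := conj_mem_ball hρ (isContraction_filterOp hP hQ) hε
    ((hsNorm_one_sub_filterOp hP hQ hρ.nonneg).trans h)
  refine iInf₂_le_of_le _ h3 (iSup₂_le fun σ hσ => ?_)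
  have h4 := fidelity_filterOp_le hP hQ hρ (Real.rpow_nonneg hb0.le _)
    (Real.rpow_nonneg hb0.le _) h1 h2 hσ
  rw [← Real.rpow_add hb0] at h4
  rw [elogb]
  split_ifs with h5
  · exact_mod_cast (Real.logb_le_iff_le_rpow hb h5).2 h4
  · exact bot_le

lemma le_smoothMaxEntropy (hb : 1 < b) (hρ : IsState ρ) (hε : 0 ≤ ε) (hε1 : ε < 1)
    (hP : IsStarProjection P) (hQ : IsStarProjection Q)
    (h1 : P * ρ * P ≤ (b ^ (-t)) • 1) (h2 : Q ≤ (b ^ s) • marginalRight ρ)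
    (h : filterDefect P Q ρ ≤ √(1 - ε ^ 2) / 2) :
    ((t - s + Real.logb b ((√(1 - ε ^ 2) / 2) ^ 2) : ℝ) : EReal) ≤ smoothMaxEntropy b ε ρ := by
  have hb0 : 0 < b := by linarith
  have hc := sqrt_one_sub_sq_pos hε hε1
  refine le_iInf₂ fun τ hτ =>
    le_iSup₂_of_le _ (isState_marginalRight hρ).isSubnormalized ?_
  have h3 := sqrt_sub_le_of_mem_ball hP hQ hρ hε (Real.rpow_pos_of_pos hb0 _)
    (Real.rpow_pos_of_pos hb0 _) h1 h2 hτ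
  rw [← Real.rpow_add hb0] at h3
  have h4 : (√(1 - ε ^ 2) / 2) ^ 2
      ≤ b ^ (-t + s) * fidelity τ ((1 : Matrix A A ℂ) ⊗ₖ marginalRight ρ) := by
    have := pow_le_pow_left₀ (n := 2) (by positivity)
      (show √(1 - ε ^ 2) / 2 ≤ √(b ^ (-t + s)) *
        sqrtFidelity τ ((1 : Matrix A A ℂ) ⊗ₖ marginalRight ρ) by linarith)
    rwa [mul_pow, Real.sq_sqrt (Real.rpow_nonneg hb0.le _)] at this
  have h5 : 0 < fidelity τ ((1 : Matrix A A ℂ) ⊗ₖ marginalRight ρ) :=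
    pos_of_mul_pos_right (lt_of_lt_of_le (by positivity) h4) (Real.rpow_nonneg hb0.le _)
  have h6 := Real.logb_le_logb_of_le hb (by positivity) h4
  rw [Real.logb_mul (Real.rpow_pos_of_pos hb0 _).ne' h5.ne', Real.logb_rpow hb0 hb.ne'] at h6
  rw [elogb, if_pos h5]
  exact_mod_cast (by linarith)

end EntropyBounds

/-! ### Spectral projections in a fixed eigenbasis -/

section Spectral

variable {J : Type*} [Fintype J] [DecidableEq J]

open scoped Classical in
/-- The projection onto the span of the columns of `U` with index in `S`. -/
def columnProj (U : Matrix J J ℂ) (S : Set J) : Matrix J J ℂ :=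
  U * diagonal (fun j => if j ∈ S then 1 else 0) * Uᴴ

variable {U : Matrix J J ℂ} {d : J → ℝ} {S : Set J}

lemma conj_mul_conj (hU : Uᴴ * U = 1) (X Y : Matrix J J ℂ) :
    (U * X * Uᴴ) * (U * Y * Uᴴ) = U * (X * Y) * Uᴴ := by
  calc _ = U * X * (Uᴴ * U) * Y * Uᴴ := by simp only [mul_assoc]
    _ = _ := by rw [hU, mul_one, mul_assoc U]

lemma trace_conj (hU : Uᴴ * U = 1) (X : Matrix J J ℂ) : (U * X * Uᴴ).trace = X.trace := by
  rw [trace_mul_comm, ← mul_assoc, hU, one_mul]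

lemma isStarProjection_columnProj (hU : Uᴴ * U = 1) : IsStarProjection (columnProj U S) where
  isIdempotentElem := by
    rw [IsIdempotentElem, columnProj, conj_mul_conj hU, diagonal_mul_diagonal]
    congr 3
    ext j
    split_ifs <;> simp
  isSelfAdjoint := by
    rw [IsSelfAdjoint, star_eq_conjTranspose, columnProj, conjTranspose_mul, conjTranspose_mul,
      conjTranspose_conjTranspose, diagonal_conjTranspose, mul_assoc]
    congr 3
    ext j
    simp [apply_ite]

lemma diagonal_le_diagonal {x y : J → ℂ} (h : ∀ j, x j ≤ y j) : diagonal x ≤ diagonal y := by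
  rw [Matrix.le_iff, diagonal_sub]
  exact posSemidef_diagonal_iff.2 fun j => sub_nonneg.2 (h j)

lemma columnProj_mul_mul_le (hU : Uᴴ * U = 1) (hU' : U * Uᴴ = 1) {μ : ℝ} (hμ : 0 ≤ μ)
    (h : ∀ j ∈ S, d j ≤ μ) :
    columnProj U S * (U * diagonal (fun j => (d j : ℂ)) * Uᴴ) * columnProj U S ≤ μ • 1 := by
  rw [columnProj, conj_mul_conj hU, conj_mul_conj hU, diagonal_mul_diagonal,
    diagonal_mul_diagonal]
  have h1 : μ • (1 : Matrix J J ℂ) = U * diagonal (fun _ => (μ : ℂ)) * Uᴴ := by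
    have : diagonal (fun _ : J => (μ : ℂ)) = μ • (1 : Matrix J J ℂ) := by
      ext i j; simp [diagonal_apply, one_apply]
    rw [this, mul_smul_comm, mul_one, smul_mul_assoc, hU']
  rw [h1]
  refine conj_le_conj' (diagonal_le_diagonal fun j => ?_) U
  split_ifs with hj
  · simpa using h j hj
  · simpa using hμ

lemma columnProj_le {θ : ℝ} (hθ : 0 ≤ θ) (hd : ∀ j, 0 ≤ d j)
    (h : ∀ j ∈ S, 1 ≤ θ * d j) :
    columnProj U S ≤ θ • (U * diagonal (fun j => (d j : ℂ)) * Uᴴ) := by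
  have h1 : θ • (U * diagonal (fun j => (d j : ℂ)) * Uᴴ)
      = U * diagonal (fun j => ((θ * d j : ℝ) : ℂ)) * Uᴴ := by
    have : diagonal (fun j => ((θ * d j : ℝ) : ℂ)) = θ • diagonal (fun j => (d j : ℂ)) := by
      ext i j; simp [diagonal_apply]
    rw [this, mul_smul_comm, smul_mul_assoc]
  rw [h1]
  refine conj_le_conj' (diagonal_le_diagonal fun j => ?_) U
  split_ifs with hj
  · exact_mod_cast h j hj
  · exact_mod_cast mul_nonneg hθ (hd j)

open scoped Classical in
lemma trace_one_sub_columnProj_mul (hU : Uᴴ * U = 1) :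
    ((1 - columnProj U S) * (U * diagonal (fun j => (d j : ℂ)) * Uᴴ)).trace.re
      = ∑ j, if j ∈ S then 0 else d j := by
  rw [sub_mul, one_mul, columnProj, conj_mul_conj hU, diagonal_mul_diagonal, trace_sub,
    trace_conj hU, trace_conj hU, trace_diagonal, trace_diagonal, ← Finset.sum_sub_distrib,
    Complex.re_sum]
  refine Finset.sum_congr rfl fun j _ => ?_
  split_ifs <;> simp

end Spectral

/-! ### A Chernoff bound -/

section LargeDeviation

variable {I : Type*} [Fintype I]

/-- A one-sided weak law of large numbers. -/
lemma tendsto_tail_sum {d : I → ℝ} (hd : ∀ i, 0 ≤ d i) (hd1 : ∑ i, d i = 1) (f : I → ℝ) {c : ℝ}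
    (hc : ∑ i, d i * f i < c) :
    Tendsto (fun n : ℕ => ∑ x : Fin n → I, if n * c ≤ ∑ i, f (x i) then ∏ i, d (x i) else 0)
      atTop (𝓝 0) := by
  -- The moment generating function of `f - c`. Here `φ 0 = 1` and `φ' 0 < 0`, so `φ s < 1` for some
  -- `s > 0`, and the tail is at most `φ s ^ n`.
  let φ : ℝ → ℝ := fun s => ∑ i, d i * Real.exp (s * (f i - c))
  have hφ0 : φ 0 = 1 := by simp [φ, hd1]
  have hφ' : HasDerivAt φ (∑ i, d i * (f i - c)) 0 := by
    refine HasDerivAt.fun_sum fun i _ => ?_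
    have h := (((hasDerivAt_id (0 : ℝ)).mul_const (f i - c)).exp).const_mul (d i)
    simpa using h
  have hneg : ∑ i, d i * (f i - c) < 0 := by
    simp only [mul_sub, Finset.sum_sub_distrib, ← Finset.sum_mul, hd1]
    linarith
  obtain ⟨s, hs0, hs⟩ : ∃ s > 0, φ s < 1 := by
    have h1 := hφ'.tendsto_slope.mono_left (nhdsWithin_mono (0 : ℝ)
      (show Set.Ioi 0 ⊆ ({0}ᶜ : Set ℝ) from fun x (hx : 0 < x) => hx.ne'))
    have h2 := (h1.eventually_lt_const hneg).and self_mem_nhdsWithin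
    obtain ⟨s, hs, hs0⟩ := h2.exists
    refine ⟨s, hs0, ?_⟩
    rw [slope_def_field, hφ0, sub_zero] at hs
    have := (div_neg_iff.1 hs).resolve_left (fun h => absurd h.2 (not_lt.2 (le_of_lt hs0)))
    linarith [this.1]
  have hφnn : 0 ≤ φ s := Finset.sum_nonneg fun i _ => mul_nonneg (hd i) (Real.exp_pos _).le
  refine squeeze_zero (fun n => Finset.sum_nonneg fun x _ => ?_) (fun n => ?_)
    (tendsto_pow_atTop_nhds_zero_of_lt_one hφnn hs)
  · split_ifs
    exacts [Finset.prod_nonneg fun i _ => hd _, le_rfl]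
  · have : φ s ^ n = ∑ x : Fin n → I, ∏ i, (d (x i) * Real.exp (s * (f (x i) - c))) := by
      rw [Finset.sum_pow', Fintype.piFinset_univ]
    rw [this]
    refine Finset.sum_le_sum fun x _ => ?_
    have hp : 0 ≤ ∏ i, d (x i) := Finset.prod_nonneg fun i _ => hd _
    rw [Finset.prod_mul_distrib, ← Real.exp_sum, ← Finset.mul_sum, Finset.sum_sub_distrib]
    split_ifs with h
    · refine le_mul_of_one_le_right hp (Real.one_le_exp (mul_nonneg hs0.le ?_))
      simpa using h
    · positivity

end LargeDeviation

/-! ### Typical projections of tensor powers -/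

section TensorPower

variable {I : Type*} [Fintype I] [DecidableEq I]

/-- The `n`-fold tensor power of a matrix. -/
def tensorPower {I : Type*} (n : ℕ) (M : Matrix I I ℂ) : Matrix (Fin n → I) (Fin n → I) ℂ :=
  Matrix.of fun p q => ∏ i, M (p i) (q i)

lemma tensorPower_mul (n : ℕ) (M N : Matrix I I ℂ) :
    tensorPower n (M * N) = tensorPower n M * tensorPower n N := by
  ext p q
  simp only [tensorPower, of_apply, mul_apply, ← Finset.prod_mul_distrib]
  exact Fintype.prod_sum _

lemma tensorPower_conjTranspose (n : ℕ) (M : Matrix I I ℂ) :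
    (tensorPower n M)ᴴ = tensorPower n Mᴴ := by
  ext p q
  simp [tensorPower]

lemma tensorPower_diagonal (n : ℕ) (d : I → ℂ) :
    tensorPower n (diagonal d) = diagonal fun p => ∏ i, d (p i) := by
  ext p q
  by_cases h : p = q
  · subst h; simp [tensorPower]
  · obtain ⟨i, hi⟩ := Function.ne_iff.1 h
    rw [diagonal_apply_ne _ h]
    exact Finset.prod_eq_zero (Finset.mem_univ i) (diagonal_apply_ne _ hi)

lemma tensorPower_one (n : ℕ) : tensorPower n (1 : Matrix I I ℂ) = 1 := by
  rw [← diagonal_one, tensorPower_diagonal]; simp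

lemma trace_tensorPower (n : ℕ) (M : Matrix I I ℂ) :
    (tensorPower n M).trace = M.trace ^ n := by
  simp [trace, tensorPower, Finset.sum_pow', Fintype.piFinset_univ]

lemma tensorPower_conj_diagonal (n : ℕ) (U : Matrix I I ℂ) (d : I → ℝ) :
    tensorPower n (U * diagonal (fun j => (d j : ℂ)) * Uᴴ)
      = tensorPower n U * diagonal (fun p => ((∏ i, d (p i) : ℝ) : ℂ)) * (tensorPower n U)ᴴ := by
  rw [tensorPower_mul, tensorPower_mul, tensorPower_diagonal, tensorPower_conjTranspose]
  push_cast
  rfl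

/-- Spectral decomposition of a state, together with its entropy. -/
lemma IsState.exists_spectral {M : Matrix I I ℂ} (hM : IsState M) (b : ℝ) :
    ∃ (U : Matrix I I ℂ) (d : I → ℝ), Uᴴ * U = 1 ∧ U * Uᴴ = 1 ∧ (∀ i, 0 ≤ d i) ∧
      ∑ i, d i = 1 ∧ M = U * diagonal (fun j => (d j : ℂ)) * Uᴴ ∧
      vonNeumannEntropy b M = -∑ i, d i * Real.logb b (d i) := by
  have hH := hM.1.isHermitian
  have hU : ((hH.eigenvectorUnitary : Matrix I I ℂ))ᴴ * (hH.eigenvectorUnitary : Matrix I I ℂ) = 1 :=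
    Unitary.coe_star_mul_self hH.eigenvectorUnitary
  have hM' : M = (hH.eigenvectorUnitary : Matrix I I ℂ)
      * diagonal (fun j => (hH.eigenvalues j : ℂ)) * (hH.eigenvectorUnitary : Matrix I I ℂ)ᴴ := by
    conv_lhs => rw [hH.spectral_theorem, Unitary.conjStarAlgAut_apply]
    rfl
  refine ⟨hH.eigenvectorUnitary, hH.eigenvalues, hU, Unitary.coe_mul_star_self _,
    fun i => hM.1.eigenvalues_nonneg i, ?_, hM', ?_⟩
  · have h := hM.2
    rw [hM', trace_conj hU, trace_diagonal] at h
    exact_mod_cast h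
  · have hcfc : cfc (Real.logb b) M = (hH.eigenvectorUnitary : Matrix I I ℂ)
        * diagonal (fun j => (Real.logb b (hH.eigenvalues j) : ℂ))
        * (hH.eigenvectorUnitary : Matrix I I ℂ)ᴴ := by
      rw [hH.cfc_eq, Matrix.IsHermitian.cfc, Unitary.conjStarAlgAut_apply]
      rfl
    rw [vonNeumannEntropy, hcfc]
    conv_lhs => enter [1, 1, 1, 1]; rw [hM']
    rw [conj_mul_conj hU, trace_conj hU, diagonal_mul_diagonal, trace_diagonal, Complex.re_sum]
    congr 1
    refine Finset.sum_congr rfl fun i _ => ?_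
    rw [← Complex.ofReal_mul, Complex.ofReal_re]

lemma logb_prod_eq {n : ℕ} {b : ℝ} {d : I → ℝ} {x : Fin n → I} (h : ∏ i, d (x i) ≠ 0) :
    Real.logb b (∏ i, d (x i)) = ∑ i, Real.logb b (d (x i)) :=
  Real.logb_prod _ _ fun i hi => Finset.prod_ne_zero_iff.1 h i hi

variable {b : ℝ} {M : Matrix I I ℂ} {δ : ℝ}

/-- Projections onto the small eigenvalues of a tensor power. -/
lemma exists_typical_upper (hb : 1 < b) (hM : IsState M) (hδ : 0 < δ) :
    ∃ P : ∀ n : ℕ, Matrix (Fin n → I) (Fin n → I) ℂ,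
      (∀ n, IsStarProjection (P n) ∧ P n * tensorPower n M * P n
        ≤ (b ^ (-(n * (vonNeumannEntropy b M - δ)))) • 1) ∧
      Tendsto (fun n => ((1 - P n) * tensorPower n M).trace.re) atTop (𝓝 0) := by
  classical
  have hb0 : 0 < b := by linarith
  obtain ⟨U, d, hU, hU', hd, hd1, rfl, hH⟩ := hM.exists_spectral b
  set H := vonNeumannEntropy b (U * diagonal (fun j => (d j : ℂ)) * Uᴴ)
  have hUn (n : ℕ) : (tensorPower n U)ᴴ * tensorPower n U = 1 := by
    rw [tensorPower_conjTranspose, ← tensorPower_mul, hU, tensorPower_one]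
  have hUn' (n : ℕ) : tensorPower n U * (tensorPower n U)ᴴ = 1 := by
    rw [tensorPower_conjTranspose, ← tensorPower_mul, hU', tensorPower_one]
  refine ⟨fun n => columnProj (tensorPower n U) {x | ∏ i, d (x i) ≤ b ^ (-(n * (H - δ)))},
    fun n => ⟨isStarProjection_columnProj (hUn n), ?_⟩, ?_⟩
  · rw [tensorPower_conj_diagonal]
    exact columnProj_mul_mul_le (hUn n) (hUn' n) (Real.rpow_nonneg hb0.le _) fun x hx => hx
  · refine squeeze_zero (fun n => ?_) (fun n => ?_)
      (tendsto_tail_sum hd hd1 (fun i => Real.logb b (d i)) (c := -(H - δ)) (by linarith))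
    · rw [tensorPower_conj_diagonal, trace_one_sub_columnProj_mul (hUn n)]
      exact Finset.sum_nonneg fun x _ => by
        split_ifs
        exacts [le_rfl, Finset.prod_nonneg fun i _ => hd _]
    · rw [tensorPower_conj_diagonal, trace_one_sub_columnProj_mul (hUn n)]
      refine Finset.sum_le_sum fun x _ => ?_
      have hp : 0 ≤ ∏ i, d (x i) := Finset.prod_nonneg fun i _ => hd _
      by_cases hx : x ∈ {x : Fin n → I | ∏ i, d (x i) ≤ b ^ (-(n * (H - δ)))}
      · rw [if_pos hx]; split_ifs <;> first | exact hp | exact le_rfl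
      · rw [if_neg hx, if_pos]
        rw [Set.mem_ofPred_eq, not_le] at hx
        have hx0 := (Real.rpow_pos_of_pos hb0 _).trans hx
        rw [← logb_prod_eq hx0.ne', Real.le_logb_iff_rpow_le hb hx0]
        rw [mul_neg]
        exact hx.le

/-- Projections onto the large eigenvalues of a tensor power. -/
lemma exists_typical_lower (hb : 1 < b) (hM : IsState M) (hδ : 0 < δ) :
    ∃ P : ∀ n : ℕ, Matrix (Fin n → I) (Fin n → I) ℂ,
      (∀ n, IsStarProjection (P n) ∧
        P n ≤ (b ^ (n * (vonNeumannEntropy b M + δ))) • tensorPower n M) ∧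
      Tendsto (fun n => ((1 - P n) * tensorPower n M).trace.re) atTop (𝓝 0) := by
  classical
  have hb0 : 0 < b := by linarith
  obtain ⟨U, d, hU, hU', hd, hd1, rfl, hH⟩ := hM.exists_spectral b
  set H := vonNeumannEntropy b (U * diagonal (fun j => (d j : ℂ)) * Uᴴ)
  have hUn (n : ℕ) : (tensorPower n U)ᴴ * tensorPower n U = 1 := by
    rw [tensorPower_conjTranspose, ← tensorPower_mul, hU, tensorPower_one]
  refine ⟨fun n => columnProj (tensorPower n U) {x | b ^ (-(n * (H + δ))) ≤ ∏ i, d (x i)},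
    fun n => ⟨isStarProjection_columnProj (hUn n), ?_⟩, ?_⟩
  · rw [tensorPower_conj_diagonal]
    refine columnProj_le (Real.rpow_nonneg hb0.le _)
      (fun x => Finset.prod_nonneg fun i _ => hd _) fun x hx => ?_
    rw [Set.mem_ofPred_eq, Real.rpow_neg hb0.le, inv_le_iff_one_le_mul₀'
      (Real.rpow_pos_of_pos hb0 _)] at hx
    exact hx
  · refine squeeze_zero (fun n => ?_) (fun n => ?_)
      (tendsto_tail_sum hd hd1 (fun i => -Real.logb b (d i)) (c := H + δ)
        (by simp only [mul_neg, Finset.sum_neg_distrib]; linarith))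
    · rw [tensorPower_conj_diagonal, trace_one_sub_columnProj_mul (hUn n)]
      exact Finset.sum_nonneg fun x _ => by
        split_ifs
        exacts [le_rfl, Finset.prod_nonneg fun i _ => hd _]
    · rw [tensorPower_conj_diagonal, trace_one_sub_columnProj_mul (hUn n)]
      refine Finset.sum_le_sum fun x _ => ?_
      have hp : 0 ≤ ∏ i, d (x i) := Finset.prod_nonneg fun i _ => hd _
      by_cases hx : x ∈ {x : Fin n → I | b ^ (-(n * (H + δ))) ≤ ∏ i, d (x i)}
      · rw [if_pos hx]; split_ifs <;> first | exact hp | exact le_rfl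
      · rw [if_neg hx]
        -- Zero eigenvalues fail the threshold too. There the logarithm of the product need not be
        -- the sum of the logarithms, as `logb b 0 = 0`, but such terms carry no weight.
        rcases hp.eq_or_lt with hx0 | hx0
        · rw [← hx0]; split_ifs <;> exact le_rfl
        rw [if_pos]
        rw [Set.mem_ofPred_eq, not_le] at hx
        rw [Finset.sum_neg_distrib, ← logb_prod_eq hx0.ne', le_neg,
          Real.logb_le_iff_le_rpow hb hx0]
        exact hx.le

end TensorPower

/-! ### Invariance under relabelling of the basis -/

section Reindex

variable {I J : Type*} [Fintype I] [DecidableEq I] [Fintype J] [DecidableEq J] (e : J ≃ I)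

lemma submatrix_mul_equiv' (X Y : Matrix I I ℂ) :
    (X * Y).submatrix e e = X.submatrix e e * Y.submatrix e e :=
  (submatrix_mul_equiv X Y e e e).symm

lemma trace_submatrix_equiv (X : Matrix I I ℂ) : (X.submatrix e e).trace = X.trace := by
  simp only [trace, diag_apply, submatrix_apply]
  exact e.sum_comp fun i => X i i

lemma submatrix_le_submatrix {X Y : Matrix I I ℂ} (h : X ≤ Y) :
    X.submatrix e e ≤ Y.submatrix e e :=
  Matrix.le_iff.2 ((Matrix.le_iff.1 h).submatrix e)

lemma isStarProjection_submatrix {P : Matrix I I ℂ} (hP : IsStarProjection P) :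
    IsStarProjection (P.submatrix e e) where
  isIdempotentElem := by
    rw [IsIdempotentElem, ← submatrix_mul_equiv', hP.isIdempotentElem.eq]
  isSelfAdjoint := by
    rw [IsSelfAdjoint, star_eq_conjTranspose, conjTranspose_submatrix, hP.conjTranspose_eq]

end Reindex

/-! ### Filters for the i.i.d. state -/

section IID

variable {A B : Type*} [Fintype A] [DecidableEq A] [Fintype B] [DecidableEq B]
variable {ρ : Matrix (A × B) (A × B) ℂ} {b δ : ℝ}

lemma iidPower_eq (n : ℕ) (ρ : Matrix (A × B) (A × B) ℂ) :
    iidPower n ρ = (tensorPower n ρ).submatrix (Equiv.arrowProdEquivProdArrow (Fin n) _ _).symm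
      (Equiv.arrowProdEquivProdArrow (Fin n) _ _).symm := rfl

lemma marginalRight_iidPower (n : ℕ) (ρ : Matrix (A × B) (A × B) ℂ) :
    marginalRight (iidPower n ρ) = tensorPower n (marginalRight ρ) := by
  ext y y'
  simp only [marginalRight, iidPower, tensorPower, of_apply]
  exact (Fintype.prod_sum fun i x => ρ (x, y i) (x, y' i)).symm

lemma isState_tensorPower {I : Type*} [Fintype I] [DecidableEq I] {M : Matrix I I ℂ}
    (hM : IsState M) (n : ℕ) : IsState (tensorPower n M) := by
  refine ⟨?_, by rw [trace_tensorPower, hM.2, one_pow]⟩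
  have h : tensorPower n M
      = (tensorPower n (CFC.sqrt M))ᴴ * tensorPower n (CFC.sqrt M) := by
    rw [tensorPower_conjTranspose, ← tensorPower_mul, sqrt_conjTranspose,
      CFC.sqrt_mul_sqrt_self M hM.nonneg]
  rw [h]
  exact posSemidef_conjTranspose_mul_self _

lemma isState_iidPower (hρ : IsState ρ) (n : ℕ) : IsState (iidPower n ρ) := by
  have h := isState_tensorPower hρ n
  refine ⟨h.1.submatrix _, ?_⟩
  rw [iidPower_eq, trace_submatrix_equiv, h.2]

lemma tendsto_filterDefect {P : ∀ n : ℕ, Matrix (Fin n → A × B) (Fin n → A × B) ℂ}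
    {Q : ∀ n : ℕ, Matrix (Fin n → B) (Fin n → B) ℂ}
    (hP : Tendsto (fun n => ((1 - P n) * tensorPower n ρ).trace.re) atTop (𝓝 0))
    (hQ : Tendsto (fun n => ((1 - Q n) * tensorPower n (marginalRight ρ)).trace.re) atTop (𝓝 0)) :
    Tendsto (fun n => filterDefect ((P n).submatrix (Equiv.arrowProdEquivProdArrow (Fin n) _ _).symm
      (Equiv.arrowProdEquivProdArrow (Fin n) _ _).symm) (Q n) (iidPower n ρ)) atTop (𝓝 0) := by
  have h := hP.sqrt.add hQ.sqrt
  rw [Real.sqrt_zero, add_zero] at h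
  refine h.congr fun n => ?_
  rw [filterDefect, marginalRight_iidPower, ← trace_submatrix_equiv
    (Equiv.arrowProdEquivProdArrow (Fin n) _ _).symm, submatrix_mul_equiv', submatrix_sub,
    Pi.sub_apply, Pi.sub_apply, submatrix_one_equiv]
  rfl

lemma exists_filter_upper (hb : 1 < b) (hρ : IsState ρ) (hδ : 0 < δ) :
    ∃ (P : ∀ n, Matrix ((Fin n → A) × (Fin n → B)) ((Fin n → A) × (Fin n → B)) ℂ)
      (Q : ∀ n, Matrix (Fin n → B) (Fin n → B) ℂ),
      (∀ n, IsStarProjection (P n) ∧ IsStarProjection (Q n) ∧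
        P n * iidPower n ρ * P n ≤ (b ^ (-(n * (vonNeumannEntropy b ρ - δ)))) • 1 ∧
        Q n ≤ (b ^ (n * (vonNeumannEntropy b (marginalRight ρ) + δ)))
          • marginalRight (iidPower n ρ)) ∧
      Tendsto (fun n => filterDefect (P n) (Q n) (iidPower n ρ)) atTop (𝓝 0) := by
  obtain ⟨P, hP, hP0⟩ := exists_typical_upper hb hρ hδ
  obtain ⟨Q, hQ, hQ0⟩ := exists_typical_lower hb (isState_marginalRight hρ) hδ
  refine ⟨fun n => (P n).submatrix (Equiv.arrowProdEquivProdArrow (Fin n) _ _).symm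
      (Equiv.arrowProdEquivProdArrow (Fin n) _ _).symm, Q, fun n =>
    ⟨isStarProjection_submatrix _ (hP n).1, (hQ n).1, ?_, ?_⟩, ?_⟩
  · have h := submatrix_le_submatrix (Equiv.arrowProdEquivProdArrow (Fin n) _ _).symm (hP n).2
    rw [submatrix_mul_equiv', submatrix_mul_equiv', submatrix_smul, Pi.smul_apply,
      Pi.smul_apply, submatrix_one_equiv] at h
    exact h
  · rw [marginalRight_iidPower]
    exact (hQ n).2
  · exact tendsto_filterDefect hP0 hQ0

lemma exists_filter_lower (hb : 1 < b) (hρ : IsState ρ) (hδ : 0 < δ) :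
    ∃ (P : ∀ n, Matrix ((Fin n → A) × (Fin n → B)) ((Fin n → A) × (Fin n → B)) ℂ)
      (Q : ∀ n, Matrix (Fin n → B) (Fin n → B) ℂ),
      (∀ n, IsStarProjection (P n) ∧ IsStarProjection (Q n) ∧
        P n ≤ (b ^ (n * (vonNeumannEntropy b ρ + δ))) • iidPower n ρ ∧
        Q n * marginalRight (iidPower n ρ) * Q n
          ≤ (b ^ (-(n * (vonNeumannEntropy b (marginalRight ρ) - δ)))) • 1) ∧
      Tendsto (fun n => filterDefect (P n) (Q n) (iidPower n ρ)) atTop (𝓝 0) := by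
  obtain ⟨P, hP, hP0⟩ := exists_typical_lower hb hρ hδ
  obtain ⟨Q, hQ, hQ0⟩ := exists_typical_upper hb (isState_marginalRight hρ) hδ
  refine ⟨fun n => (P n).submatrix (Equiv.arrowProdEquivProdArrow (Fin n) _ _).symm
      (Equiv.arrowProdEquivProdArrow (Fin n) _ _).symm, Q, fun n =>
    ⟨isStarProjection_submatrix _ (hP n).1, (hQ n).1, ?_, ?_⟩, ?_⟩
  · have h := submatrix_le_submatrix (Equiv.arrowProdEquivProdArrow (Fin n) _ _).symm (hP n).2
    rw [submatrix_smul] at h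
    exact h
  · rw [marginalRight_iidPower]
    exact (hQ n).2
  · exact tendsto_filterDefect hP0 hQ0

end IID

/-! ### Limits of normalized extended-real sequences -/

section Limits

lemma tendsto_linear_div (x K : ℝ) :
    Tendsto (fun n : ℕ => ((n * x + K : ℝ) : EReal) / (n : EReal)) atTop (𝓝 (x : EReal)) := by
  have h : Tendsto (fun n : ℕ => x + K / n) atTop (𝓝 x) := by
    simpa using (tendsto_const_nhds (x := x)).add (tendsto_const_div_atTop_nhds_zero_nat K)
  refine (EReal.tendsto_coe.2 h).congr' ?_
  filter_upwards [eventually_gt_atTop 0] with n hn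
  have hn' : (n : ℝ) ≠ 0 := by positivity
  rw [← EReal.coe_coe_eq_natCast, ← EReal.coe_div]
  congr 1
  field_simp

variable {u : ℕ → EReal} {H l : ℝ}

lemma le_of_tendsto_div (hl : Tendsto (fun n => u n / (n : EReal)) atTop (𝓝 (l : EReal)))
    (h : ∀ δ > 0, ∃ K : ℝ, ∀ᶠ n : ℕ in atTop, u n ≤ ((n * (H + δ) + K : ℝ) : EReal)) : l ≤ H := by
  refine le_of_forall_pos_le_add fun δ hδ => ?_
  obtain ⟨K, hK⟩ := h δ hδ
  have := le_of_tendsto_of_tendsto hl (tendsto_linear_div (H + δ) K)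
    (hK.mono fun n hn => EReal.div_le_div_right_of_nonneg n.cast_nonneg' hn)
  exact_mod_cast this

lemma ge_of_tendsto_div (hl : Tendsto (fun n => u n / (n : EReal)) atTop (𝓝 (l : EReal)))
    (h : ∀ δ > 0, ∃ K : ℝ, ∀ᶠ n : ℕ in atTop, ((n * (H - δ) + K : ℝ) : EReal) ≤ u n) : H ≤ l := by
  refine le_of_forall_pos_sub_le fun δ hδ => ?_
  obtain ⟨K, hK⟩ := h δ hδ
  have := le_of_tendsto_of_tendsto (tendsto_linear_div (H - δ) K) hl
    (hK.mono fun n hn => EReal.div_le_div_right_of_nonneg n.cast_nonneg' hn)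
  exact_mod_cast this

lemma tendsto_div_of_linear_bounds
    (h1 : ∀ δ > 0, ∃ K : ℝ, ∀ᶠ n : ℕ in atTop, ((n * (H - δ) + K : ℝ) : EReal) ≤ u n)
    (h2 : ∀ δ > 0, ∃ K : ℝ, ∀ᶠ n : ℕ in atTop, u n ≤ ((n * (H + δ) + K : ℝ) : EReal)) :
    Tendsto (fun n => u n / (n : EReal)) atTop (𝓝 (H : EReal)) := by
  refine tendsto_order.2 ⟨fun a ha => ?_, fun a ha => ?_⟩
  · obtain ⟨r, har, hr⟩ := EReal.lt_iff_exists_real_btwn.1 ha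
    have hr' : r < H := by exact_mod_cast hr
    obtain ⟨K, hK⟩ := h1 ((H - r) / 2) (by linarith)
    have h3 := (tendsto_linear_div (H - (H - r) / 2) K).eventually_const_lt
      (show (r : EReal) < _ by exact_mod_cast (by linarith))
    filter_upwards [hK, h3] with n hn hn'
    exact (har.trans hn').trans_le (EReal.div_le_div_right_of_nonneg n.cast_nonneg' hn)
  · obtain ⟨r, hr, har⟩ := EReal.lt_iff_exists_real_btwn.1 ha
    have hr' : H < r := by exact_mod_cast hr
    obtain ⟨K, hK⟩ := h2 ((r - H) / 2) (by linarith)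
    have h3 := (tendsto_linear_div (H + (r - H) / 2) K).eventually_lt_const
      (show _ < (r : EReal) by exact_mod_cast (by linarith))
    filter_upwards [hK, h3] with n hn hn'
    exact (EReal.div_le_div_right_of_nonneg n.cast_nonneg' hn).trans_lt (hn'.trans har)

/-- Fekete's lemma for superadditive extended reals. -/
lemma exists_tendsto_div_of_superadditive (hadd : ∀ m n, u m + u n ≤ u (m + n))
    (hbot : ∀ n, u n ≠ ⊥) {C : ℝ} (hC : ∀ n : ℕ, u n ≤ ((n * C : ℝ) : EReal)) :
    ∃ l : ℝ, Tendsto (fun n => u n / (n : EReal)) atTop (𝓝 (l : EReal)) := by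
  have htop (n : ℕ) : u n ≠ ⊤ := ((hC n).trans_lt (EReal.coe_lt_top _)).ne
  lift u to ℕ → ℝ using fun n => ⟨htop n, hbot n⟩ with v
  have hsub : Subadditive fun n => -v n := fun m n => by
    have : v m + v n ≤ v (m + n) := by exact_mod_cast hadd m n
    linarith
  have hbdd : BddBelow (Set.range fun n : ℕ => -v n / n) := by
    -- The absolute value covers the term `n = 0`, where the quotient is `0` by convention.
    refine ⟨-|C|, ?_⟩
    rintro _ ⟨n, rfl⟩
    have h : v n ≤ n * C := by exact_mod_cast hC n
    rcases n.eq_zero_or_pos with rfl | hn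
    · simp
    · have hn' : (0 : ℝ) < n := by exact_mod_cast hn
      change -|C| ≤ -v n / n
      rw [le_div_iff₀ hn']
      nlinarith [le_abs_self C]
  refine ⟨-hsub.lim, ?_⟩
  refine (EReal.tendsto_coe.2 (hsub.tendsto_lim hbdd).neg).congr fun n => ?_
  rw [← EReal.coe_coe_eq_natCast, ← EReal.coe_div, neg_div, neg_neg]

end Limits

/-! ### Tensor products of contractions, states and fidelities -/

section Kronecker

variable {I J K : Type*} [Fintype I] [DecidableEq I] [Fintype J] [DecidableEq J]
  [Fintype K] [DecidableEq K]

lemma kronecker_nonneg {X : Matrix I I ℂ} {Y : Matrix J J ℂ} (hX : 0 ≤ X) (hY : 0 ≤ Y) :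
    0 ≤ X ⊗ₖ Y :=
  Matrix.nonneg_iff_posSemidef.2 ((Matrix.nonneg_iff_posSemidef.1 hX).kronecker
    (Matrix.nonneg_iff_posSemidef.1 hY))

lemma kronecker_mono {X X' : Matrix I I ℂ} {Y Y' : Matrix J J ℂ} (hX : X ≤ X') (hY : Y ≤ Y')
    (hX0 : 0 ≤ X) (hY0 : 0 ≤ Y') : X ⊗ₖ Y ≤ X' ⊗ₖ Y' := by
  have h := add_nonneg (kronecker_nonneg (sub_nonneg.2 hX) hY0)
    (kronecker_nonneg hX0 (sub_nonneg.2 hY))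
  rw [← sub_nonneg]
  convert h using 1
  ext p q
  simp only [Matrix.sub_apply, Matrix.add_apply, kroneckerMap_apply]
  ring

lemma isContraction_kronecker_submatrix {V : Matrix I I ℂ} {W : Matrix J J ℂ}
    (hV : IsContraction V) (hW : IsContraction W) (e : K ≃ I × J) :
    IsContraction ((V ⊗ₖ W).submatrix e e) := by
  rw [IsContraction, conjTranspose_submatrix, ← submatrix_mul_equiv', conjTranspose_kronecker,
    ← mul_kronecker_mul]
  have h := submatrix_le_submatrix e (kronecker_mono hV hW
    (Matrix.nonneg_iff_posSemidef.2 (posSemidef_conjTranspose_mul_self V)) zero_le_one)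
  rwa [one_kronecker_one, submatrix_one_equiv] at h

lemma submatrix_nonneg {X : Matrix I I ℂ} (hX : 0 ≤ X) (e : J ≃ I) : 0 ≤ X.submatrix e e :=
  submatrix_le_submatrix e hX

/-- The root fidelity is supermultiplicative under tensor products. -/
lemma sqrtFidelity_mul_le {ρ τ : Matrix I I ℂ} {ρ' τ' : Matrix J J ℂ} (hρ : 0 ≤ ρ) (hτ : 0 ≤ τ)
    (hρ' : 0 ≤ ρ') (hτ' : 0 ≤ τ') (e : K ≃ I × J) :
    sqrtFidelity ρ τ * sqrtFidelity ρ' τ'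
      ≤ sqrtFidelity ((ρ ⊗ₖ ρ').submatrix e e) ((τ ⊗ₖ τ').submatrix e e) := by
  obtain ⟨W, hW, h⟩ := exists_contraction_trace_eq (CFC.sqrt ρ * CFC.sqrt τ)
  obtain ⟨W', hW', h'⟩ := exists_contraction_trace_eq (CFC.sqrt ρ' * CFC.sqrt τ')
  have hsq {X : Matrix I I ℂ} {Y : Matrix J J ℂ} (hX : 0 ≤ X) (hY : 0 ≤ Y) :
      (CFC.sqrt X ⊗ₖ CFC.sqrt Y).submatrix e e * ((CFC.sqrt X ⊗ₖ CFC.sqrt Y).submatrix e e)ᴴ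
        = (X ⊗ₖ Y).submatrix e e := by
    rw [conjTranspose_submatrix, ← submatrix_mul_equiv', conjTranspose_kronecker,
      ← mul_kronecker_mul, sqrt_conjTranspose, sqrt_conjTranspose, CFC.sqrt_mul_sqrt_self X,
      CFC.sqrt_mul_sqrt_self Y]
  have h1 := trNorm_le_sqrtFidelity (submatrix_nonneg (kronecker_nonneg hρ hρ') e)
    (submatrix_nonneg (kronecker_nonneg hτ hτ') e) (hsq hρ hρ').le (hsq hτ hτ').le
  refine le_trans ?_ h1
  -- The product `W ⊗ W'` of the optimal contractions is a test contraction for the tensor product,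
  -- where the trace factorizes.
  refine le_trans ?_
    (norm_trace_contraction_mul_le (isContraction_kronecker_submatrix hW hW' e) _)
  rw [conjTranspose_submatrix, ← submatrix_mul_equiv', ← submatrix_mul_equiv',
    conjTranspose_kronecker, ← mul_kronecker_mul, ← mul_kronecker_mul, sqrt_conjTranspose,
    sqrt_conjTranspose, trace_submatrix_equiv, trace_kronecker, norm_mul]
  rw [← sqrtFidelity_eq] at h h'
  rw [← h, ← h']
  have h0 : 0 ≤ (W' * (CFC.sqrt ρ' * CFC.sqrt τ')).trace.re := h' ▸ sqrtFidelity_nonneg _ _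
  exact mul_le_mul (Complex.re_le_norm _) (Complex.re_le_norm _) h0 (norm_nonneg _)

lemma isSubnormalized_kronecker {σ : Matrix I I ℂ} {σ' : Matrix J J ℂ}
    (hσ : IsSubnormalized σ) (hσ' : IsSubnormalized σ') (e : K ≃ I × J) :
    IsSubnormalized ((σ ⊗ₖ σ').submatrix e e) := by
  refine ⟨(hσ.1.kronecker hσ'.1).submatrix e, ?_⟩
  have him : σ.trace.im = 0 := (Complex.le_def.1 hσ.1.trace_nonneg).2.symm
  rw [trace_submatrix_equiv, trace_kronecker, Complex.mul_re, him, zero_mul, sub_zero]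
  exact mul_le_one₀ hσ.2 (trace_re_nonneg hσ'.nonneg) hσ'.2

end Kronecker

/-! ### Superadditivity and linear bounds for the unsmoothed entropies -/

section Additivity

variable {A B : Type*} [Fintype A] [DecidableEq A] [Fintype B] [DecidableEq B]
variable {ρ : Matrix (A × B) (A × B) ℂ} {b : ℝ}

/-- Splitting `Aᵐ⁺ⁿBᵐ⁺ⁿ` as `AᵐBᵐ ⊗ AⁿBⁿ`. -/
def splitEquiv (A B : Type*) (m n : ℕ) : ((Fin (m + n) → A) × (Fin (m + n) → B)) ≃
    ((Fin m → A) × (Fin m → B)) × ((Fin n → A) × (Fin n → B)) :=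
  ((Fin.appendEquiv m n).symm.prodCongr (Fin.appendEquiv m n).symm).trans
    (Equiv.prodProdProdComm _ _ _ _)

lemma iidPower_add (m n : ℕ) (ρ : Matrix (A × B) (A × B) ℂ) :
    iidPower (m + n) ρ = (iidPower m ρ ⊗ₖ iidPower n ρ).submatrix (splitEquiv A B m n)
      (splitEquiv A B m n) := by
  ext p q
  simp only [iidPower, of_apply, submatrix_apply, kroneckerMap_apply, Fin.prod_univ_add]
  rfl

lemma one_kronecker_split (m n : ℕ) (σ : Matrix (Fin m → B) (Fin m → B) ℂ)
    (σ' : Matrix (Fin n → B) (Fin n → B) ℂ) :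
    (1 : Matrix (Fin (m + n) → A) (Fin (m + n) → A) ℂ) ⊗ₖ
        ((σ ⊗ₖ σ').submatrix (Fin.appendEquiv m n).symm (Fin.appendEquiv m n).symm)
      = (((1 : Matrix (Fin m → A) (Fin m → A) ℂ) ⊗ₖ σ) ⊗ₖ
          ((1 : Matrix (Fin n → A) (Fin n → A) ℂ) ⊗ₖ σ')).submatrix (splitEquiv A B m n)
          (splitEquiv A B m n) := by
  rw [← submatrix_one_equiv (Fin.appendEquiv (α := A) m n).symm, ← one_kronecker_one]
  ext p q
  simp only [submatrix_apply, kroneckerMap_apply]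
  exact mul_mul_mul_comm _ _ _ _

/-- Tensoring two operator inequalities makes `σ ⊗ σ'` admissible with exponent `t + t'`. Arguing
below each supremum avoids having to attain it. -/
lemma minEntropy_add_le (hb : 1 < b) (hρ : IsState ρ) (m n : ℕ) :
    minEntropy b (iidPower m ρ) + minEntropy b (iidPower n ρ)
      ≤ minEntropy b (iidPower (m + n) ρ) := by
  have hb0 : 0 < b := by linarith
  refine EReal.add_le_of_forall_lt fun x hx y hy => ?_
  simp only [minEntropy, lt_iSup_iff] at hx hy
  obtain ⟨σ, hσ, t, ht, hxt⟩ := hx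
  obtain ⟨σ', hσ', t', ht', hyt⟩ := hy
  refine (add_le_add hxt.le hyt.le).trans ?_
  rw [← EReal.coe_add]
  refine le_iSup₂_of_le _ (isSubnormalized_kronecker hσ hσ' (Fin.appendEquiv m n).symm)
    (le_iSup₂_of_le (t + t') ?_ le_rfl)
  have h := submatrix_le_submatrix (splitEquiv A B m n)
    (kronecker_mono ht ht' (isState_iidPower hρ m).nonneg
    ((isState_iidPower hρ n).nonneg.trans ht'))
  rw [smul_kronecker, kronecker_smul, smul_smul, ← Real.rpow_add hb0, submatrix_smul,
    Pi.smul_apply, Pi.smul_apply, ← one_kronecker_split, ← iidPower_add] at h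
  rwa [neg_add]

lemma maxEntropy_add_le (hb : 1 < b) (hρ : IsState ρ) (m n : ℕ) :
    maxEntropy b (iidPower m ρ) + maxEntropy b (iidPower n ρ)
      ≤ maxEntropy b (iidPower (m + n) ρ) := by
  refine EReal.add_le_of_forall_lt fun x hx y hy => ?_
  simp only [maxEntropy, lt_iSup_iff] at hx hy
  obtain ⟨σ, hσ, hxt⟩ := hx
  obtain ⟨σ', hσ', hyt⟩ := hy
  refine (add_le_add hxt.le hyt.le).trans ?_
  refine le_iSup₂_of_le _ (isSubnormalized_kronecker hσ hσ' (Fin.appendEquiv m n).symm) ?_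
  rw [elogb] at hxt hyt
  split_ifs at hxt hyt with h1 h2 h2
  · have h := sqrtFidelity_mul_le (isState_iidPower hρ m).nonneg
      (one_kronecker_nonneg (A := Fin m → A) hσ.nonneg) (isState_iidPower hρ n).nonneg
      (one_kronecker_nonneg (A := Fin n → A) hσ'.nonneg) (splitEquiv A B m n)
    rw [← one_kronecker_split, ← iidPower_add] at h
    have h3 := pow_le_pow_left₀ (mul_nonneg (sqrtFidelity_nonneg _ _) (sqrtFidelity_nonneg _ _)) h 2
    rw [mul_pow] at h3
    simp only [← fidelity.eq_1] at h3
    have h4 := mul_pos h1 h2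
    rw [elogb, elogb, elogb, if_pos h1, if_pos h2, if_pos (h4.trans_le h3), ← EReal.coe_add,
      ← Real.logb_mul h1.ne' h2.ne']
    exact_mod_cast Real.logb_le_logb_of_le hb h4 h3
  -- A vanishing fidelity has logarithm `⊥`, which nothing lies strictly below.
  · exact absurd hyt not_lt_bot
  · exact absurd hxt not_lt_bot
  · exact absurd hxt not_lt_bot

lemma IsState.le_one {I : Type*} [Fintype I] [DecidableEq I] {M : Matrix I I ℂ} (hM : IsState M) :
    M ≤ 1 := by
  obtain ⟨U, d, hU, hU', hd, hd1, hMU, -⟩ := hM.exists_spectral 2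
  have h : U * diagonal (fun j => (d j : ℂ)) * Uᴴ ≤ U * diagonal (fun _ => 1) * Uᴴ := by
    refine conj_le_conj' (diagonal_le_diagonal fun j => ?_) U
    have : d j ≤ 1 := hd1 ▸ Finset.single_le_sum (fun i _ => hd i) (Finset.mem_univ j)
    exact_mod_cast this
  rwa [diagonal_one, mul_one, hU', ← hMU] at h

lemma IsState.nonempty {I : Type*} [Fintype I] {M : Matrix I I ℂ} (hM : IsState M) :
    Nonempty I := by
  by_contra h
  rw [not_nonempty_iff] at h
  have := hM.2
  simp [trace] at this

lemma isSubnormalized_uniform {I : Type*} [Fintype I] [DecidableEq I] [Nonempty I] :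
    IsSubnormalized (((Fintype.card I : ℝ)⁻¹) • (1 : Matrix I I ℂ)) := by
  refine ⟨PosSemidef.one.smul (by positivity), ?_⟩
  rw [trace_smul, trace_one, Complex.smul_re, Complex.natCast_re, smul_eq_mul, inv_mul_cancel₀]
  exact_mod_cast Fintype.card_ne_zero

lemma trace_one_kronecker_re (σ : Matrix B B ℂ) :
    ((1 : Matrix A A ℂ) ⊗ₖ σ).trace.re = Fintype.card A * σ.trace.re := by
  rw [trace_kronecker, trace_one, ← Complex.ofReal_natCast, Complex.re_ofReal_mul]

/-- The maximally mixed `σ = 1/|B|` is a witness, because `ρ ≤ 1 = |B| (1 ⊗ σ)`. -/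
lemma minEntropy_ne_bot (hb : 1 < b) (hρ : IsState ρ) : minEntropy b ρ ≠ ⊥ := by
  have hb0 : 0 < b := by linarith
  obtain ⟨-, y⟩ := hρ.nonempty.some
  have : Nonempty B := ⟨y⟩
  have hc : (0 : ℝ) < Fintype.card B := by exact_mod_cast Fintype.card_pos
  refine ne_bot_of_le_ne_bot (EReal.coe_ne_bot (-Real.logb b (Fintype.card B))) ?_
  refine le_iSup₂_of_le _ isSubnormalized_uniform (le_iSup₂_of_le _ ?_ le_rfl)
  rw [neg_neg, Real.rpow_logb hb0 hb.ne' hc, kronecker_smul, smul_smul, mul_inv_cancel₀ hc.ne',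
    one_smul, one_kronecker_one]
  exact hρ.le_one

/-- Taking traces in `ρ ≤ b^{-t} (1 ⊗ σ)` gives `1 ≤ b^{-t} |A|`. On `n` copies the bound is linear
in `n`, as Fekete's lemma requires. -/
lemma minEntropy_le (hb : 1 < b) (hρ : IsState ρ) :
    minEntropy b ρ ≤ (Real.logb b (Fintype.card A) : EReal) := by
  have hb0 : 0 < b := by linarith
  refine iSup₂_le fun σ hσ => iSup₂_le fun t ht => ?_
  have h := trace_re_mono ht
  rw [hρ.2, Complex.one_re, trace_smul, Complex.smul_re, trace_one_kronecker_re, smul_eq_mul] at h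
  have h1 : 1 ≤ b ^ (-t) * (Fintype.card A : ℝ) := by
    refine h.trans ?_
    gcongr
    exact mul_le_of_le_one_right (by positivity) hσ.2
  rw [Real.rpow_neg hb0.le, ← div_eq_inv_mul, one_le_div (Real.rpow_pos_of_pos hb0 _)] at h1
  have h2 := (Real.le_logb_iff_rpow_le hb ((Real.rpow_pos_of_pos hb0 _).trans_le h1)).2 h1
  exact_mod_cast h2

lemma maxEntropy_ne_bot (hρ : IsState ρ) : maxEntropy b ρ ≠ ⊥ := by
  obtain ⟨-, y⟩ := hρ.nonempty.some
  have : Nonempty B := ⟨y⟩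
  have hc : (0 : ℝ) < Fintype.card B := by exact_mod_cast Fintype.card_pos
  set σ : Matrix B B ℂ := ((Fintype.card B : ℝ)⁻¹) • (1 : Matrix B B ℂ)
  have hσ : IsSubnormalized σ := isSubnormalized_uniform
  set c : ℝ := √((Fintype.card B : ℝ)⁻¹)
  have hc' : 0 < c := Real.sqrt_pos.2 (inv_pos.2 hc)
  -- As `ρ ≤ 1`, the operator `c √ρ` is a factor of `c² ρ ≤ 1 ⊗ σ`; the fidelity is therefore at
  -- least `c² > 0`.
  have h1 : trNorm ((CFC.sqrt ρ)ᴴ * (c • CFC.sqrt ρ))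
      ≤ sqrtFidelity ρ ((1 : Matrix A A ℂ) ⊗ₖ σ) := by
    refine trNorm_le_sqrtFidelity hρ.nonneg (one_kronecker_nonneg hσ.nonneg) ?_ ?_
    · rw [sqrt_conjTranspose, CFC.sqrt_mul_sqrt_self ρ hρ.nonneg]
    · rw [conjTranspose_smul, sqrt_conjTranspose, smul_mul_smul_comm,
        CFC.sqrt_mul_sqrt_self ρ hρ.nonneg, star_trivial, Real.mul_self_sqrt (by positivity),
        kronecker_smul, one_kronecker_one]
      exact smul_mono_left (by positivity) hρ.le_one
  have h2 := trace_re_le_trNorm ((CFC.sqrt ρ)ᴴ * (c • CFC.sqrt ρ))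
  rw [sqrt_conjTranspose, mul_smul_comm, CFC.sqrt_mul_sqrt_self ρ hρ.nonneg, trace_smul, hρ.2,
    Complex.smul_re, Complex.one_re, smul_eq_mul, mul_one] at h2
  rw [sqrt_conjTranspose, mul_smul_comm, CFC.sqrt_mul_sqrt_self ρ hρ.nonneg] at h1
  have h3 : 0 < fidelity ρ ((1 : Matrix A A ℂ) ⊗ₖ σ) := pow_pos (by linarith) 2
  refine ne_bot_of_le_ne_bot (EReal.coe_ne_bot
    (Real.logb b (fidelity ρ ((1 : Matrix A A ℂ) ⊗ₖ σ)))) (le_iSup₂_of_le σ hσ ?_)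
  rw [elogb, if_pos h3]

lemma maxEntropy_le (hb : 1 < b) (hρ : IsState ρ) :
    maxEntropy b ρ ≤ (Real.logb b (Fintype.card A) : EReal) := by
  refine iSup₂_le fun σ hσ => ?_
  rw [elogb]
  split_ifs with h
  · have h1 := pow_le_pow_left₀ (trNorm_nonneg _)
      (trNorm_le_mul (CFC.sqrt ρ) (CFC.sqrt ((1 : Matrix A A ℂ) ⊗ₖ σ))) 2
    rw [hsNorm_sqrt_of_isState hρ, one_mul, hsNorm_sqrt_sq (one_kronecker_nonneg hσ.nonneg),
      trace_one_kronecker_re] at h1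
    have h2 : fidelity ρ ((1 : Matrix A A ℂ) ⊗ₖ σ) ≤ Fintype.card A :=
      h1.trans (mul_le_of_le_one_right (by positivity) hσ.2)
    exact_mod_cast Real.logb_le_logb_of_le hb h h2
  · exact bot_le

end Additivity

/-! ### Asymptotic bounds on the smooth entropies -/

section Main

variable {A B : Type*} [Fintype A] [DecidableEq A] [Fintype B] [DecidableEq B]
variable {ρ : Matrix (A × B) (A × B) ℂ} {b ε : ℝ}

lemma logb_card_fun (n : ℕ) :
    Real.logb b (Fintype.card (Fin n → A)) = n * Real.logb b (Fintype.card A) := by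
  rw [Fintype.card_fun, Fintype.card_fin, Nat.cast_pow, Real.logb_pow]

lemma exists_tendsto_smoothMinEntropy_zero (hb : 1 < b) (hρ : IsState ρ) :
    ∃ l : ℝ, Tendsto (fun n : ℕ => smoothMinEntropy b 0 (iidPower n ρ) / (n : EReal))
      atTop (𝓝 (l : EReal)) := by
  have h (n : ℕ) : smoothMinEntropy b 0 (iidPower n ρ) = minEntropy b (iidPower n ρ) := by
    rw [smoothMinEntropy, ball_zero (isState_iidPower hρ n), iSup_singleton]
  simp only [h]
  refine exists_tendsto_div_of_superadditive (minEntropy_add_le hb hρ)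
    (fun n => minEntropy_ne_bot hb (isState_iidPower hρ n))
    (C := Real.logb b (Fintype.card A)) fun n => ?_
  rw [← logb_card_fun]
  exact minEntropy_le hb (isState_iidPower hρ n)

lemma exists_tendsto_smoothMaxEntropy_zero (hb : 1 < b) (hρ : IsState ρ) :
    ∃ l : ℝ, Tendsto (fun n : ℕ => smoothMaxEntropy b 0 (iidPower n ρ) / (n : EReal))
      atTop (𝓝 (l : EReal)) := by
  have h (n : ℕ) : smoothMaxEntropy b 0 (iidPower n ρ) = maxEntropy b (iidPower n ρ) := by
    rw [smoothMaxEntropy, ball_zero (isState_iidPower hρ n), iInf_singleton]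
  simp only [h]
  refine exists_tendsto_div_of_superadditive (maxEntropy_add_le hb hρ)
    (fun n => maxEntropy_ne_bot (isState_iidPower hρ n))
    (C := Real.logb b (Fintype.card A)) fun n => ?_
  rw [← logb_card_fun]
  exact maxEntropy_le hb (isState_iidPower hρ n)

lemma smoothMinEntropy_iid_le (hb : 1 < b) (hρ : IsState ρ) (hε : 0 ≤ ε) (hε1 : ε < 1)
    {δ : ℝ} (hδ : 0 < δ) : ∃ K : ℝ, ∀ᶠ n : ℕ in atTop,
      smoothMinEntropy b ε (iidPower n ρ) ≤ ((n * (condEntropy b ρ + δ) + K : ℝ) : EReal) := by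
  -- Half of `δ` goes to the spectrum of `ρ_AB` and half to that of `ρ_B`.
  obtain ⟨P, Q, h, hη⟩ := exists_filter_lower hb hρ (half_pos hδ)
  refine ⟨-Real.logb b ((√(1 - ε ^ 2) / 2) ^ 2), ?_⟩
  filter_upwards [hη.eventually_le_const (half_pos (sqrt_one_sub_sq_pos hε hε1))] with n hn
  obtain ⟨h1, h2, h3, h4⟩ := h n
  refine (smoothMinEntropy_le hb (isState_iidPower hρ n) hε hε1 h1 h2 h3 h4 hn).trans_eq ?_
  rw [condEntropy]
  congr 1
  ring

lemma le_smoothMaxEntropy_iid (hb : 1 < b) (hρ : IsState ρ) (hε : 0 ≤ ε) (hε1 : ε < 1)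
    {δ : ℝ} (hδ : 0 < δ) : ∃ K : ℝ, ∀ᶠ n : ℕ in atTop,
      ((n * (condEntropy b ρ - δ) + K : ℝ) : EReal) ≤ smoothMaxEntropy b ε (iidPower n ρ) := by
  obtain ⟨P, Q, h, hη⟩ := exists_filter_upper hb hρ (half_pos hδ)
  refine ⟨Real.logb b ((√(1 - ε ^ 2) / 2) ^ 2), ?_⟩
  filter_upwards [hη.eventually_le_const (half_pos (sqrt_one_sub_sq_pos hε hε1))] with n hn
  obtain ⟨h1, h2, h3, h4⟩ := h n
  refine le_trans (le_of_eq ?_)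
    (le_smoothMaxEntropy hb (isState_iidPower hρ n) hε hε1 h1 h2 h3 h4 hn)
  rw [condEntropy]
  congr 1
  ring

lemma one_sub_sqrt_pos (hε : 0 < ε) : 0 < 1 - √(1 - ε ^ 2) := by
  rw [sub_pos, Real.sqrt_lt' one_pos]
  nlinarith

/-- Strict positivity of `ε` makes `1 - √(1 - ε²)` positive, so the vanishing defect eventually fits
inside the ball. -/
lemma le_smoothMinEntropy_iid (hb : 1 < b) (hρ : IsState ρ) (hε : 0 < ε)
    {δ : ℝ} (hδ : 0 < δ) : ∃ K : ℝ, ∀ᶠ n : ℕ in atTop,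
      ((n * (condEntropy b ρ - δ) + K : ℝ) : EReal) ≤ smoothMinEntropy b ε (iidPower n ρ) := by
  obtain ⟨P, Q, h, hη⟩ := exists_filter_upper hb hρ (half_pos hδ)
  refine ⟨0, ?_⟩
  filter_upwards [hη.eventually_le_const (one_sub_sqrt_pos hε)] with n hn
  obtain ⟨h1, h2, h3, h4⟩ := h n
  refine le_trans (le_of_eq ?_)
    (le_smoothMinEntropy hb (isState_iidPower hρ n) hε.le h1 h2 h3 h4 hn)
  rw [condEntropy]
  congr 1
  ring

lemma smoothMaxEntropy_iid_le (hb : 1 < b) (hρ : IsState ρ) (hε : 0 < ε)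
    {δ : ℝ} (hδ : 0 < δ) : ∃ K : ℝ, ∀ᶠ n : ℕ in atTop,
      smoothMaxEntropy b ε (iidPower n ρ) ≤ ((n * (condEntropy b ρ + δ) + K : ℝ) : EReal) := by
  obtain ⟨P, Q, h, hη⟩ := exists_filter_lower hb hρ (half_pos hδ)
  refine ⟨0, ?_⟩
  filter_upwards [hη.eventually_le_const (one_sub_sqrt_pos hε)] with n hn
  obtain ⟨h1, h2, h3, h4⟩ := h n
  refine (smoothMaxEntropy_le hb (isState_iidPower hρ n) hε.le h1 h2 h3 h4 hn).trans_eq ?_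
  rw [condEntropy]
  congr 1
  ring

end Main

end QInfo

end

theorem mainTheorem6 {A B : Type*} [Fintype A] [DecidableEq A] [Fintype B] [DecidableEq B]
    (b : ℝ) (hb : 1 < b) (ρ : Matrix (A × B) (A × B) ℂ) (hρ : QInfo.IsState ρ)
    (ε : ℝ) (hε0 : 0 ≤ ε) (hε1 : ε < 1) :
    (∃ l : ℝ,
      Tendsto (fun n : ℕ => QInfo.smoothMinEntropy b ε (QInfo.iidPower n ρ) / (n : EReal))
        atTop (𝓝 (l : EReal)) ∧
      l ≤ QInfo.condEntropy b ρ) ∧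
    (∃ l : ℝ,
      Tendsto (fun n : ℕ => QInfo.smoothMaxEntropy b ε (QInfo.iidPower n ρ) / (n : EReal))
        atTop (𝓝 (l : EReal)) ∧
      QInfo.condEntropy b ρ ≤ l) := by
  have hmin := fun δ (hδ : 0 < δ) => QInfo.smoothMinEntropy_iid_le hb hρ hε0 hε1 hδ
  have hmax := fun δ (hδ : 0 < δ) => QInfo.le_smoothMaxEntropy_iid hb hρ hε0 hε1 hδ
  rcases hε0.eq_or_lt with rfl | hε
  · obtain ⟨l, hl⟩ := QInfo.exists_tendsto_smoothMinEntropy_zero hb hρ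
    obtain ⟨l', hl'⟩ := QInfo.exists_tendsto_smoothMaxEntropy_zero hb hρ
    exact ⟨⟨l, hl, QInfo.le_of_tendsto_div hl hmin⟩, ⟨l', hl', QInfo.ge_of_tendsto_div hl' hmax⟩⟩
  · exact ⟨⟨_, QInfo.tendsto_div_of_linear_bounds
      (fun δ hδ => QInfo.le_smoothMinEntropy_iid hb hρ hε hδ) hmin, le_rfl⟩,
      ⟨_, QInfo.tendsto_div_of_linear_bounds hmax
      (fun δ hδ => QInfo.smoothMaxEntropy_iid_le hb hρ hε hδ), le_rfl⟩⟩
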